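/- Let $\widetilde K$ be a locally finite simplicial complex which is a closed (boundaryless) oriented $4$-dimensional pseudomanifold: every simplex lies in a $4$-simplex, every $3$-simplex lies in exactly two $4$-simplices, and the $4$-simplices are consistently oriented. Let a group $\Gamma$ act on $\widetilde K$ by orientation-preserving simplicial automorphisms so that no $\gamma\neq 1$ maps a simplex onto itself, and let $K=\widetilde K/\Gamma$ have finitely many edges and $2$-faces. (The main case: $\widetilde K$ is the universal cover of a triangulated closed oriented $4$-manifold $K$, and $\Gamma=\pi_1(K)$.) Let a flat Euclidean realisation be given: a map of the vertices of $\widetilde K$ to $\mathbb R^4$ under which every $4$-simplex $\sigma$ is nondegenerate, and which is equivariant with respect to a homomorphism from $\Gamma$ to the group of proper motions of $\mathbb R^4$. Let $\varepsilon_\sigma=\pm1$ be the orientation of the image of $\sigma$ in $\mathbb R^4$, and let $L_a$ be the squared length of the edge $a$ of $K$. (i) For a $2$-face $i$ of $K$, the deficit angle is $\omega_i=-\sum_{\sigma\supset i}\varepsilon_\sigma\vartheta_{\sigma,i}$ (modulo $2\pi$), the sum being over the $4$-simplices around $i$, where the dihedral angle $\vartheta_{\sigma,i}$ of $\sigma$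 at $i$ is regarded as a function of the squared edge lengths of $\sigma$ and the signs $\varepsilon_\sigma$ are kept fixed. The derivatives $\partial\omega_i/\partial L_a$ are taken at the lengths of the realisation. The map $(\partial\Omega_a/\partial S_i)$ from area differentials $(dS_i)$ on the $2$-faces of $K$ to differentials $(d\Omega_a)$ of deficit angles around the edges of $K$ is the one with the conjugate (transposed) matrix, $d\Omega_a=\sum_i (\partial\omega_i/\partial L_a)\,dS_i$. (ii) An edge deviation is a choice, for every edge $a$ of $K$, of a vector $d\vec v_a\in\mathbb R^4$ orthogonal to that edge, transported to all lifts of the edge by the motions of $\Gamma$. The map $(\partial S_i/\partial\vec v_a)$ sends edge deviations to the area differentials $dS_{ABC}=4S_{A'B'C'}-S_{ABC}$ (first-order part in the deviations), where $A',B',C'$ are obtained from the midpoints of $BC$, $CA$, $AB$ by adding $d\vec v_{BC}$, $d\vec v_{CA}$, $d\vec v_{AB}$, and $S$ denotes the area of a triangle. Then $$\operatorname{Im}\left(\frac{\partial S_i}{\partial\vec v_a}\right)\subset\operatorname{Ker}\left(\frac{\partial\Omega_a}{\partial S_i}\right),$$ i.e. area differentials generated by edge deviations always give $d\Omega_a=0$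 at every edge $a$. -/

import Mathlib

noncomputable section

/-- Euclidean four-space. -/
abbrev E4 : Type := EuclideanSpace ℝ (Fin 4)

/-- A closed (that is, boundaryless) oriented locally finite triangulation of dimension four.
The fields say that it is a pure simplicial complex, a pseudomanifold with a consistent
orientation of its 4-simplices. Every triangulation of an oriented topological or PL 4-manifold without boundary
satisfies them; nothing more is asked for, so that singular spaces are allowed as well. -/
structure OrientedTriangulation4 (V : Type*) extends AbstractSimplicialComplex V where
  /-- every vertex lies in finitely many simplices only -/
  locallyFinite : ∀ x : V, {σ ∈ faces | x ∈ σ}.Finite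
  /-- every simplex is a face of a 4-simplex -/
  pure : ∀ τ ∈ faces, ∃ σ ∈ faces, τ ⊆ σ ∧ σ.card = 5
  /-- there are no simplices of dimension more than four -/
  card_le : ∀ σ ∈ faces, σ.card ≤ 5
  /-- every 3-simplex lies in exactly two 4-simplices -/
  closed : ∀ τ ∈ faces, τ.card = 4 → {σ ∈ faces | τ ⊆ σ ∧ σ.card = 5}.ncard = 2
  /-- the positively oriented orderings `A, B, C, D, E` of the vertices of the 4-simplices -/
  pos : Set (Fin 5 ↪ V)
  /-- positive orderings are orderings of 4-simplices -/
  pos_mem : ∀ s ∈ pos, Finset.univ.map s ∈ faces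
  /-- exactly the orderings of a 4-simplex that differ from a positive one by an even permutation
  are positive, and there are positive and negative ones -/
  pos_perm : ∀ s : Fin 5 ↪ V, Finset.univ.map s ∈ faces → ∀ π : Equiv.Perm (Fin 5),
    (π.toEmbedding.trans s ∈ pos ↔ (s ∈ pos ↔ Equiv.Perm.sign π = 1))
  /-- neighbouring 4-simplices `ABCDE` and `ABCDF` are consistently oriented: just one of these
  two orderings is positive -/
  coherent : ∀ s ∈ pos, ∀ t : Fin 5 ↪ V, Finset.univ.map t ∈ faces →
    (∀ j : Fin 4, t j.castSucc = s j.castSucc) → t 4 ≠ s 4 → t ∉ pos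

/-- The determinant of the matrix of scalar products of `B - A, C - A, X - A` with
`B - A, C - A, Y - A`, expressed through squared distances `L`. For points of a Euclidean space it
equals `4 S_ABC ^ 2` times the scalar product of the components of `X - A` and `Y - A` orthogonal
to the plane `ABC`. -/
def borderedGram {V : Type*} (L : V → V → ℝ) (A B C X Y : V) : ℝ :=
  let g : V → V → ℝ := fun P Q => (L A P + L A Q - L P Q) / 2
  Matrix.det !![g B B, g B C, g B Y;
                g C B, g C C, g C Y;
                g X B, g X C, g X Y]

/-- The dihedral angle of the Euclidean 4-simplex `s 0, …, s 4` with squared edge lengths `L` at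
its two-dimensional face `s 0, s 1, s 2`: the angle between the components of `s 3 - s 0` and
`s 4 - s 0` orthogonal to the plane of the face. -/
def dihedralAngle {V : Type*} (L : V → V → ℝ) (s : Fin 5 → V) : ℝ :=
  Real.arccos (borderedGram L (s 0) (s 1) (s 2) (s 3) (s 4) /
    Real.sqrt (borderedGram L (s 0) (s 1) (s 2) (s 3) (s 3) *
      borderedGram L (s 0) (s 1) (s 2) (s 4) (s 4)))

/-- The area of the triangle with vertices `x, y, z`. -/
def triangleArea (x y z : E4) : ℝ :=
  Real.sqrt (‖y - x‖ ^ 2 * ‖z - x‖ ^ 2 - inner ℝ (y - x) (z - x) ^ 2) / 2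

/-- `4 S_{A'B'C'} - S_{ABC}`, where `C', A', B'` are the middles of the sides `AB`, `BC`, `CA` of
the triangle `p 0, p 1, p 2`, displaced by `w 0`, `w 1`, `w 2`. -/
def areaIncrement (p : Fin 3 → E4) (w : Fin 3 → E4) : ℝ :=
  4 * triangleArea (midpoint ℝ (p 0) (p 1) + w 0) (midpoint ℝ (p 1) (p 2) + w 1)
      (midpoint ℝ (p 2) (p 0) + w 2)
    - triangleArea (p 0) (p 1) (p 2)

/-- `1` on the pairs of vertices that are lifts of the edge `a` of the quotient by `Γ`, and `0`
on all other pairs: the direction in which the squared length of that edge alone varies. -/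
def edgeClass {V : Type*} (Γ : Type*) [Group Γ] [MulAction Γ V] (a : Fin 2 ↪ V) (x y : V) : ℝ :=
  open Classical in
  if ∃ γ : Γ, (x = γ • a 0 ∧ y = γ • a 1) ∨ (x = γ • a 1 ∧ y = γ • a 0) then 1 else 0

namespace OrientedTriangulation4

variable {V : Type*}

/-- `u` lists the vertices of a simplex. -/
def IsCell (K : OrientedTriangulation4 V) {n : ℕ} (u : Fin n ↪ V) : Prop :=
  Finset.univ.map u ∈ K.faces

/-- `x` and `y` are the two ends of an edge. -/
def IsEdge (K : OrientedTriangulation4 V) (x y : V) : Prop :=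
  x ≠ y ∧ ∃ σ ∈ K.faces, x ∈ σ ∧ y ∈ σ

/-- `Γ` acts on the triangulation as the deck group of a covering of an oriented manifold: by
orientation preserving automorphisms and freely, no simplex being mapped onto itself by an
element other than `1`. -/
structure IsDeckAction (K : OrientedTriangulation4 V) (Γ : Type*) [Group Γ] [MulAction Γ V] :
    Prop where
  pos_smul : ∀ γ : Γ, ∀ s ∈ K.pos, s.trans (MulAction.toPerm γ).toEmbedding ∈ K.pos
  free : ∀ γ : Γ, ∀ σ ∈ K.faces, (∀ x ∈ σ, γ • x ∈ σ) → γ = 1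

/-- `R` contains exactly one lift, with one ordering of its vertices, of every simplex with `n`
vertices of the quotient by `Γ`. Thus `R` serves as the (finite) set of these simplices. -/
def IsCellSystem (K : OrientedTriangulation4 V) (Γ : Type*) [Group Γ] [MulAction Γ V] {n : ℕ}
    (R : Finset (Fin n ↪ V)) : Prop :=
  (∀ u ∈ R, K.IsCell u) ∧
    ∀ w : Fin n ↪ V, K.IsCell w →
      ∃! u : Fin n ↪ V, u ∈ R ∧ ∃ (γ : Γ) (π : Equiv.Perm (Fin n)), ∀ j, w j = γ • u (π j)

/-- A flat Euclidean realisation: the vertices are put in Euclidean four-space so that all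
4-simplices are nondegenerate and that `Γ` acts through proper motions. -/
structure FlatRealisation (K : OrientedTriangulation4 V) (Γ : Type*) [Group Γ]
    [MulAction Γ V] where
  /-- the images of the vertices -/
  pt : V → E4
  /-- the representation of `Γ` by motions -/
  hol : Γ →* (E4 ≃ᵃⁱ[ℝ] E4)
  nondegenerate : ∀ s ∈ K.pos, AffineIndependent ℝ (fun j => pt (s j))
  equivariant : ∀ (γ : Γ) (x : V), pt (γ • x) = hol γ (pt x)
  proper : ∀ γ : Γ,
    LinearMap.det ((hol γ).linearIsometryEquiv.toLinearEquiv : E4 →ₗ[ℝ] E4) = 1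

namespace FlatRealisation

variable {K : OrientedTriangulation4 V} {Γ : Type*} [Group Γ] [MulAction Γ V]

/-- The squared distances between the realised vertices. -/
def sqDist (f : K.FlatRealisation Γ) (x y : V) : ℝ := dist (f.pt x) (f.pt y) ^ 2

/-- The sign of a positively ordered 4-simplex: whether its realisation in Euclidean four-space
has the standard orientation. -/
def simplexSign (f : K.FlatRealisation Γ) (s : Fin 5 → V) : ℝ :=
  Real.sign (Matrix.det (Matrix.of fun j k : Fin 4 => f.pt (s j.succ) k - f.pt (s 0) k))

/-- The deficit angle `ω` at the two-dimensional face `u` (modulo `2π`), as a function of the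
squared edge lengths: minus the algebraic sum of the dihedral angles of the 4-simplices that
contain this face. Each such 4-simplex has just one positive ordering that begins
with `u 0, u 1, u 2`. The signs of the 4-simplices do not vary. -/
def deficit (f : K.FlatRealisation Γ) (L : V → V → ℝ) (u : Fin 3 ↪ V) : ℝ :=
  - ∑ᶠ (s : Fin 5 ↪ V) (_ : s ∈ K.pos ∧ s 0 = u 0 ∧ s 1 = u 1 ∧ s 2 = u 2),
      f.simplexSign s * dihedralAngle L s

/-- The matrix `(∂ω_i / ∂L_a)`, whose rows are indexed by the 2-faces and whose columns by the
edges of the quotient by `Γ`, taken at the lengths of the realisation. -/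
def deficitMatrix (f : K.FlatRealisation Γ) (E : Finset (Fin 2 ↪ V)) (F : Finset (Fin 3 ↪ V)) :
    Matrix F E ℝ :=
  Matrix.of fun i a => deriv (fun t : ℝ => f.deficit (f.sqDist + t • edgeClass Γ a.1) i.1) 0

/-- The map `(∂Ω_a / ∂S_i)` from area differentials to differentials of the deficit angles around
edges. Its matrix is conjugate to `(∂ω_i / ∂L_a)`, so that `dΩ_a = ∑ i, (∂ω_i / ∂L_a) dS_i`. -/
def edgeDeficitMap (f : K.FlatRealisation Γ) (E : Finset (Fin 2 ↪ V))
    (F : Finset (Fin 3 ↪ V)) : (F → ℝ) →ₗ[ℝ] (E → ℝ) :=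
  (f.deficitMatrix E F).transpose.mulVecLin

/-- The space of edge deviations of the quotient by `Γ`: a vector orthogonal to it for every edge,
the vectors at different lifts of an edge corresponding to each other under the motions. (The
values off the edges are irrelevant.) -/
def deviations (f : K.FlatRealisation Γ) : Submodule ℝ (V → V → E4) where
  carrier := {v | ∀ x y : V, K.IsEdge x y →
    v x y = v y x ∧ inner ℝ (v x y) (f.pt y - f.pt x) = 0 ∧
      ∀ γ : Γ, v (γ • x) (γ • y) = (f.hol γ).linearIsometryEquiv (v x y)}
  zero_mem' := fun x y _ => by simp
  add_mem' := fun {v w} hv hw x y h => by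
    obtain ⟨a1, a2, a3⟩ := hv x y h
    obtain ⟨b1, b2, b3⟩ := hw x y h
    refine ⟨by simp [a1, b1], by simp [inner_add_left, a2, b2], fun γ => ?_⟩
    simp [a3 γ, b3 γ]
  smul_mem' := fun c v hv x y h => by
    obtain ⟨a1, a2, a3⟩ := hv x y h
    refine ⟨by simp [a1], by simp [inner_smul_left, a2], fun γ => ?_⟩
    simp [a3 γ]

/-- The deviations of the three sides of the triangle `u`. -/
def sideDeviations (f : K.FlatRealisation Γ) (u : Fin 3 ↪ V) :
    f.deviations →ₗ[ℝ] (Fin 3 → E4) where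
  toFun v := ![v.1 (u 0) (u 1), v.1 (u 1) (u 2), v.1 (u 2) (u 0)]
  map_add' v w := by
    ext j : 1
    fin_cases j <;> rfl
  map_smul' c v := by
    ext j : 1
    fin_cases j <;> rfl

/-- The map `(∂S_i / ∂v_a)` from edge deviations to area differentials: `dS_i` is the first-order
part of `4 S_{A'B'C'} - S_{ABC}` in the deviations of the sides of the `i`-th 2-face. -/
def areaMap (f : K.FlatRealisation Γ) (F : Finset (Fin 3 ↪ V)) :
    f.deviations →ₗ[ℝ] (F → ℝ) :=
  LinearMap.pi fun i : F =>
    (fderiv ℝ (areaIncrement fun j => f.pt (i.1 j)) 0 : (Fin 3 → E4) →ₗ[ℝ] ℝ) ∘ₗ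
      f.sideDeviations i.1

end FlatRealisation

end OrientedTriangulation4

end

/-!
The statement is a relation between infinitesimal rotations. The first-order part of
`4 S_{A'B'C'} - S_{ABC}` is the sum over the sides of the triangle of the side length times the
outward normal component of the deviation (`fderiv_areaIncrement`). When `∑ i, (∂ω_i / ∂L_a) dS_i`
is regrouped by the sides, it is therefore enough to show, for every edge `b` and every
variation of the squared lengths, that the sum of the velocities of the deficit angles
at the 2-faces around `b`, multiplied by the unit normals of `b` in these faces, is orthogonal to
every vector that is orthogonal to `b` (`sum_sideTerm_eq_zero`).

The link of `b` in a 4-simplex is a spherical triangle. Its vertices are the unit normals mentioned,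
its angles are the dihedral angles of the 4-simplex, and its sides are dihedral angles of the three
tetrahedra around `b`. For a varying spherical triangle, the angular velocities times the vertices
add up to the velocities of the sides times the unit normals of the sides, up to sign
(`angleRate_sum`). This is an identity between rational functions of the Gram matrix once the square
roots are split off, and Sylvester's identity (`mul_borderedGram`) brings the dihedral angles into
this form. Multiplied by the sign of the 4-simplex, the contribution of a side is an expression in
the corresponding tetrahedron alone, in which the normal is the vector product of its edge vectors;
it changes sign with the orientation of the tetrahedron (`sign_mul_angleRate_sum`). As every
tetrahedron lies in two 4-simplices that induce opposite orientations on it, the contributions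
cancel (`sum_posThrough_eq_zero`).

The regrouping takes place on orbits: the lifts of 2-faces in `F` with all their orderings, and the
ordered 2-faces of the covering whose first side lies in `E`, both represent every ordered 2-face of
the quotient just once, as the action is free (`sum_faces_eq_sum_edges`).
-/

noncomputable section

/-! ### Scalar products expressed through squared distances -/

/-- A symmetric function of two arguments that vanishes on the diagonal: the formal properties of
squared distances and of their variations. -/
structure IsSqLength {V : Type*} (L : V → V → ℝ) : Prop where
  symm : ∀ x y, L x y = L y x
  diag : ∀ x, L x x = 0

theorem IsSqLength.add_smul {V : Type*} {L η : V → V → ℝ} (hL : IsSqLength L)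
    (hη : IsSqLength η) (t : ℝ) : IsSqLength (L + t • η) where
  symm x y := by simp [hL.symm x y, hη.symm x y]
  diag x := by simp [hL.diag x, hη.diag x]

/-- The scalar product of `P - A` and `Q - A`, expressed through squared distances. -/
def gramForm {V : Type*} (L : V → V → ℝ) (A P Q : V) : ℝ := (L A P + L A Q - L P Q) / 2

/-- `|B - A| ^ 2` times the scalar product of the components of `P - A` and `Q - A` orthogonal to
the edge `AB`, expressed through squared distances. As a function of `P` and `Q` it is a Gram
matrix of (unnormalized) points of the spherical link of the edge `AB`. -/
def linkForm {V : Type*} (L : V → V → ℝ) (A B P Q : V) : ℝ :=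
  gramForm L A B B * gramForm L A P Q - gramForm L A B P * gramForm L A B Q

/-- The derivative of `linkForm` at `L` in the direction `η`. -/
def linkRate {V : Type*} (L η : V → V → ℝ) (A B P Q : V) : ℝ :=
  gramForm η A B B * gramForm L A P Q + gramForm L A B B * gramForm η A P Q
    - (gramForm η A B P * gramForm L A B Q + gramForm L A B P * gramForm η A B Q)

section LinkForm

variable {V : Type*} {L η : V → V → ℝ}

theorem gramForm_comm (hL : IsSqLength L) (A P Q : V) : gramForm L A P Q = gramForm L A Q P := by
  simp only [gramForm, hL.symm P Q]
  ring

theorem gramForm_self (hL : IsSqLength L) (A P : V) : gramForm L A P P = L A P := by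
  simp only [gramForm, hL.diag P]
  ring

theorem linkForm_comm (hL : IsSqLength L) (A B P Q : V) :
    linkForm L A B P Q = linkForm L A B Q P := by
  simp only [linkForm, gramForm_comm hL A P Q]
  ring

theorem linkRate_comm (hL : IsSqLength L) (hη : IsSqLength η) (A B P Q : V) :
    linkRate L η A B P Q = linkRate L η A B Q P := by
  simp only [linkRate, gramForm_comm hL A P Q, gramForm_comm hη A P Q]
  ring

theorem hasDerivAt_gramForm (L η : V → V → ℝ) (A P Q : V) :
    HasDerivAt (fun t : ℝ => gramForm (L + t • η) A P Q) (gramForm η A P Q) 0 := by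
  have h : (fun t : ℝ => gramForm (L + t • η) A P Q)
      = fun t => gramForm L A P Q + t * gramForm η A P Q := by
    funext t
    simp only [gramForm, Pi.add_apply, Pi.smul_apply, smul_eq_mul]
    ring
  rw [h]
  simpa using ((hasDerivAt_id (0 : ℝ)).mul_const (gramForm η A P Q)).const_add (gramForm L A P Q)

theorem hasDerivAt_linkForm (L η : V → V → ℝ) (A B P Q : V) :
    HasDerivAt (fun t : ℝ => linkForm (L + t • η) A B P Q) (linkRate L η A B P Q) 0 := by
  have h := ((hasDerivAt_gramForm L η A B B).mul (hasDerivAt_gramForm L η A P Q)).sub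
    ((hasDerivAt_gramForm L η A B P).mul (hasDerivAt_gramForm L η A B Q))
  simp only [zero_smul, add_zero] at h
  exact h

theorem borderedGram_eq (L : V → V → ℝ) (A B C X Y : V) :
    borderedGram L A B C X Y = Matrix.det !![gramForm L A B B, gramForm L A B C, gramForm L A B Y;
      gramForm L A C B, gramForm L A C C, gramForm L A C Y;
      gramForm L A X B, gramForm L A X C, gramForm L A X Y] := rfl

/-- Sylvester's determinant identity, which expresses the dihedral angle of a 4-simplex at `ABC`
as an angle of the spherical link of `AB`. -/
theorem mul_borderedGram (hL : IsSqLength L) (A B C X Y : V) :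
    L A B * borderedGram L A B C X Y =
      linkForm L A B C C * linkForm L A B X Y - linkForm L A B C X * linkForm L A B C Y := by
  rw [borderedGram_eq, Matrix.det_fin_three, ← gramForm_self hL A B]
  simp only [linkForm, Matrix.of_apply, Matrix.cons_val', Matrix.cons_val_zero, Matrix.cons_val_one,
    Matrix.cons_val_fin_one, Matrix.cons_val, gramForm_comm hL A C B, gramForm_comm hL A X B,
    gramForm_comm hL A X C]
  ring

theorem borderedGram_comm (hL : IsSqLength L) (A B C X Y : V) :
    borderedGram L A B C X Y = borderedGram L A B C Y X := by
  rw [borderedGram_eq, borderedGram_eq, ← Matrix.det_transpose]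
  congr 1
  ext i j
  fin_cases i <;> fin_cases j <;> simp [Matrix.transpose_apply] <;> exact gramForm_comm hL _ _ _

theorem borderedGram_rotate (hL : IsSqLength L) (A B C X Y : V) :
    borderedGram L B C A X Y = borderedGram L A B C X Y := by
  rw [borderedGram_eq, borderedGram_eq, Matrix.det_fin_three, Matrix.det_fin_three]
  simp only [gramForm, Matrix.of_apply, Matrix.cons_val', Matrix.cons_val_zero, Matrix.cons_val_one,
    Matrix.cons_val_fin_one, Matrix.cons_val, hL.diag, hL.symm B A, hL.symm C A, hL.symm C B,
    hL.symm X A, hL.symm X B, hL.symm X C]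
  ring

theorem borderedGram_swap (hL : IsSqLength L) (A B C X Y : V) :
    borderedGram L B A C X Y = borderedGram L A B C X Y := by
  rw [borderedGram_eq, borderedGram_eq, Matrix.det_fin_three, Matrix.det_fin_three]
  simp only [gramForm, Matrix.of_apply, Matrix.cons_val', Matrix.cons_val_zero, Matrix.cons_val_one,
    Matrix.cons_val_fin_one, Matrix.cons_val, hL.diag, hL.symm B A, hL.symm C A, hL.symm C B,
    hL.symm X A, hL.symm X B, hL.symm X C]
  ring

end LinkForm

/-! ### Infinitesimal spherical trigonometry -/

/-- `k C C` times the scalar product of the components of `X` and `Y` orthogonal to `C`, for vectors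
with Gram matrix `k`. -/
def vertexForm {V : Type*} (k : V → V → ℝ) (C X Y : V) : ℝ := k C C * k X Y - k C X * k C Y

/-- The derivative of `vertexForm` when `k` varies with velocity `k'`. -/
def vertexRate {V : Type*} (k k' : V → V → ℝ) (C X Y : V) : ℝ :=
  k' C C * k X Y + k C C * k' X Y - (k' C X * k C Y + k C X * k' C Y)

/-- The Gram determinant of the three points `C`, `X`, `Y`. -/
def gramDet {V : Type*} (k : V → V → ℝ) (C X Y : V) : ℝ :=
  k C C * (k X X * k Y Y - k X Y ^ 2) - k C X * (k C X * k Y Y - k X Y * k C Y)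
    + k C Y * (k C X * k X Y - k X X * k C Y)

/-- The velocity of the angle at `C` of the spherical triangle `CXY` with Gram matrix `k`, when `k`
varies with velocity `k'`. -/
def angleRate {V : Type*} (k k' : V → V → ℝ) (C X Y : V) : ℝ :=
  -(vertexRate k k' C X Y - vertexForm k C X Y / 2 *
      (vertexRate k k' C X X / vertexForm k C X X + vertexRate k k' C Y Y / vertexForm k C Y Y)) /
    √(k C C * gramDet k C X Y)

/-- The velocity of the length of the side `CD` of a spherical triangle, divided by the area
`√(vertexForm k C D D)` of a parallelogram and taken with the opposite sign. -/
def sideRate {V : Type*} (k k' : V → V → ℝ) (C D : V) : ℝ :=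
  (k' C D - k C D / 2 * (k' C C / k C C + k' D D / k D D)) / vertexForm k C D D

theorem sideRate_comm {V : Type*} {k k' : V → V → ℝ} (hk : ∀ x y, k x y = k y x)
    (hk' : ∀ x y, k' x y = k' y x) (C D : V) : sideRate k k' C D = sideRate k k' D C := by
  simp only [sideRate, vertexForm, hk D C, hk' D C]
  ring

theorem hasDerivAt_arccos_div_sqrt {N D₁ D₂ : ℝ → ℝ} {N' D₁' D₂' x : ℝ} (hN : HasDerivAt N N' x)
    (h₁ : HasDerivAt D₁ D₁' x) (h₂ : HasDerivAt D₂ D₂' x) (p₁ : 0 < D₁ x) (p₂ : 0 < D₂ x)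
    (h : 0 < D₁ x * D₂ x - N x ^ 2) :
    HasDerivAt (fun t => Real.arccos (N t / √(D₁ t * D₂ t)))
      (-(N' - N x / 2 * (D₁' / D₁ x + D₂' / D₂ x)) / √(D₁ x * D₂ x - N x ^ 2)) x := by
  have hp : 0 < D₁ x * D₂ x := mul_pos p₁ p₂
  set r := √(D₁ x * D₂ x) with hr
  have r0 : 0 < r := Real.sqrt_pos.2 hp
  have hr2 : r ^ 2 = D₁ x * D₂ x := Real.sq_sqrt hp.le
  have hc : (N x / r) ^ 2 < 1 := by
    rw [div_pow, div_lt_one (by positivity), hr2]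
    linarith
  have hc' := abs_lt.1 ((sq_lt_one_iff_abs_lt_one _).1 hc)
  have hs : √(1 - (N x / r) ^ 2) = √(D₁ x * D₂ x - N x ^ 2) / r := by
    rw [show D₁ x * D₂ x - N x ^ 2 = (1 - (N x / r) ^ 2) * r ^ 2 by rw [← hr2]; field_simp,
      Real.sqrt_mul (by linarith), Real.sqrt_sq r0.le, mul_div_cancel_right₀ _ r0.ne']
  have hq := (Real.hasDerivAt_arccos hc'.1.ne' hc'.2.ne).comp x
    (hN.div ((h₁.mul h₂).sqrt hp.ne') r0.ne')
  refine hq.congr_deriv ?_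
  have s0 : 0 < √(D₁ x * D₂ x - N x ^ 2) := Real.sqrt_pos.2 h
  simp only [Pi.mul_apply, ← hr, hs]
  have e : N' * r - N x * ((D₁' * D₂ x + D₁ x * D₂') / (2 * r)) =
      r * (N' - N x / 2 * (D₁' / D₁ x + D₂' / D₂ x)) := by
    field_simp
    rw [hr2]
    ring
  rw [e]
  field_simp

/-- The infinitesimal closing condition of a spherical triangle `CDF`: the velocities of its angles,
as rotations around the unit vectors of its vertices, add up to the velocities of its sides, as
rotations around the unit normals of the sides. It is paired here with a test covector that takes
the values `a`, `b`, `c` at `C`, `D`, `F`. -/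
theorem angleRate_sum {V : Type*} {k k' : V → V → ℝ} (hk : ∀ x y, k x y = k y x)
    (hk' : ∀ x y, k' x y = k' y x) {C D F : V} (hC : 0 < k C C) (hD : 0 < k D D) (hF : 0 < k F F)
    (hCD : 0 < vertexForm k C D D) (hDF : 0 < vertexForm k D F F) (hFC : 0 < vertexForm k F C C)
    (hΔ : 0 < gramDet k C D F) (a b c : ℝ) :
    angleRate k k' C D F * (a / √(k C C)) + angleRate k k' D F C * (b / √(k D D))
        + angleRate k k' F C D * (c / √(k F F)) =
      -(sideRate k k' C D * (vertexForm k C D D * c - vertexForm k D C F * a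
            - vertexForm k C D F * b)
        + sideRate k k' D F * (vertexForm k D F F * a - vertexForm k F D C * b
            - vertexForm k D F C * c)
        + sideRate k k' F C * (vertexForm k F C C * b - vertexForm k C F D * c
            - vertexForm k F C D * a)) / √(gramDet k C D F) := by
  have g1 : gramDet k D F C = gramDet k C D F := by
    simp only [gramDet, hk D C, hk F C]; ring
  have g2 : gramDet k F C D = gramDet k C D F := by
    simp only [gramDet, hk F C, hk F D]; ring
  simp only [angleRate, g1, g2, Real.sqrt_mul hC.le, Real.sqrt_mul hD.le, Real.sqrt_mul hF.le]
  have r0 : 0 < √(gramDet k C D F) := Real.sqrt_pos.2 hΔ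
  have key : ∀ {p : ℝ} (_ : 0 < p) (X y : ℝ),
      -X / (√p * √(gramDet k C D F)) * (y / √p) = -(X * (y / p)) / √(gramDet k C D F) := by
    intro p hp X y
    have : 0 < √p := Real.sqrt_pos.2 hp
    rw [show y / p = y / (√p * √p) by rw [Real.mul_self_sqrt hp.le]]
    field_simp
  rw [key hC, key hD, key hF, ← add_div, ← add_div]
  congr 1
  have s1 : vertexForm k C F F = vertexForm k F C C := by
    simp only [vertexForm, hk F C]; ring
  have s2 : vertexForm k D C C = vertexForm k C D D := by
    simp only [vertexForm, hk D C]; ring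
  have s3 : vertexForm k F D D = vertexForm k D F F := by
    simp only [vertexForm, hk F D]; ring
  rw [s1, s2, s3]
  simp only [sideRate]
  generalize h1 : vertexForm k C D D = m1 at *
  generalize h2 : vertexForm k D F F = m2 at *
  generalize h3 : vertexForm k F C C = m3 at *
  simp only [vertexForm, vertexRate, hk D C, hk F C, hk F D, hk' D C, hk' F C, hk' F D] at *
  field_simp
  subst h1 h2 h3
  ring

/-- The dihedral angles of a 4-simplex `ABCXY` vary as angles of the spherical link of `AB`. -/
theorem hasDerivAt_dihedralAngle {V : Type*} {L η : V → V → ℝ} (hL : IsSqLength L)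
    (hη : IsSqLength η) {s : Fin 5 → V} (hAB : 0 < L (s 0) (s 1))
    (h₁ : 0 < vertexForm (linkForm L (s 0) (s 1)) (s 2) (s 3) (s 3))
    (h₂ : 0 < vertexForm (linkForm L (s 0) (s 1)) (s 2) (s 4) (s 4))
    (hC : 0 < linkForm L (s 0) (s 1) (s 2) (s 2))
    (hΔ : 0 < gramDet (linkForm L (s 0) (s 1)) (s 2) (s 3) (s 4)) :
    HasDerivAt (fun t : ℝ => dihedralAngle (L + t • η) s)
      (angleRate (linkForm L (s 0) (s 1)) (linkRate L η (s 0) (s 1)) (s 2) (s 3) (s 4)) 0 := by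
  have hd : ∀ X Y, HasDerivAt
      (fun t : ℝ => vertexForm (linkForm (L + t • η) (s 0) (s 1)) (s 2) X Y)
      (vertexRate (linkForm L (s 0) (s 1)) (linkRate L η (s 0) (s 1)) (s 2) X Y) 0 := by
    intro X Y
    have h := ((hasDerivAt_linkForm L η (s 0) (s 1) (s 2) (s 2)).mul
      (hasDerivAt_linkForm L η (s 0) (s 1) X Y)).sub
      ((hasDerivAt_linkForm L η (s 0) (s 1) (s 2) X).mul
      (hasDerivAt_linkForm L η (s 0) (s 1) (s 2) Y))
    simp only [zero_smul, add_zero] at h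
    exact h
  have hsq : ∀ (k : V → V → ℝ) (C X Y : V),
      vertexForm k C X X * vertexForm k C Y Y - vertexForm k C X Y ^ 2
        = k C C * gramDet k C X Y := by
    intro k C X Y
    simp only [vertexForm, gramDet]
    ring
  have h := hasDerivAt_arccos_div_sqrt (hd (s 3) (s 4)) (hd (s 3) (s 3)) (hd (s 4) (s 4))
    (by simpa using h₁) (by simpa using h₂) (by
      simp only [zero_smul, add_zero]
      rw [hsq]
      exact mul_pos hC hΔ)
  simp only [zero_smul, add_zero] at h
  rw [hsq] at h
  refine h.congr_of_eventuallyEq ?_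
  have hcont : ContinuousAt (fun t : ℝ => (L + t • η) (s 0) (s 1)) 0 := by
    simp only [Pi.add_apply, Pi.smul_apply, smul_eq_mul]
    fun_prop
  filter_upwards [hcont.eventually (lt_mem_nhds (by simpa using hAB :
    (0 : ℝ) < (L + (0 : ℝ) • η) (s 0) (s 1)))] with t ht
  have hb : ∀ X Y, vertexForm (linkForm (L + t • η) (s 0) (s 1)) (s 2) X Y =
      (L + t • η) (s 0) (s 1) * borderedGram (L + t • η) (s 0) (s 1) (s 2) X Y :=
    fun X Y => (mul_borderedGram (hL.add_smul hη t) _ _ _ _ _).symm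
  rw [dihedralAngle]
  congr 1
  rw [hb, hb, hb]
  set g := (L + t • η) (s 0) (s 1)
  rw [mul_mul_mul_comm, ← pow_two, Real.sqrt_mul (sq_nonneg g),
    Real.sqrt_sq ht.le, mul_div_mul_left _ _ ht.ne']

/-! ### Determinants of vectors in Euclidean four-space -/

/-- The determinant of four vectors of Euclidean four-space. -/
def det4 (a b c d : E4) : ℝ := Matrix.det (Matrix.of fun j k : Fin 4 => (![a, b, c, d] j) k)

/-- `|e| ^ 2` times the scalar product of the components of `p` and `q` orthogonal to `e`. -/
def perpForm (e p q : E4) : ℝ := inner ℝ e e * inner ℝ p q - inner ℝ e p * inner ℝ e q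

theorem perpForm_comm (e p q : E4) : perpForm e p q = perpForm e q p := by
  simp only [perpForm, real_inner_comm]
  ring

theorem det4_expand (a b c d : E4) : det4 a b c d =
    a 0 * (b 1 * (c 2 * d 3 - c 3 * d 2) - b 2 * (c 1 * d 3 - c 3 * d 1)
        + b 3 * (c 1 * d 2 - c 2 * d 1))
      - a 1 * (b 0 * (c 2 * d 3 - c 3 * d 2) - b 2 * (c 0 * d 3 - c 3 * d 0)
        + b 3 * (c 0 * d 2 - c 2 * d 0))
      + a 2 * (b 0 * (c 1 * d 3 - c 3 * d 1) - b 1 * (c 0 * d 3 - c 3 * d 0)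
        + b 3 * (c 0 * d 1 - c 1 * d 0))
      - a 3 * (b 0 * (c 1 * d 2 - c 2 * d 1) - b 1 * (c 0 * d 2 - c 2 * d 0)
        + b 2 * (c 0 * d 1 - c 1 * d 0)) := by
  simp [det4, Matrix.det_succ_row_zero, Fin.sum_univ_succ, Fin.succAbove]
  ring

theorem det4_rotate (e a b c : E4) : det4 e b c a = det4 e a b c := by
  rw [det4_expand, det4_expand]
  ring

theorem det4_swap (e a b c : E4) : det4 e b a c = -det4 e a b c := by
  rw [det4_expand, det4_expand]
  ring

theorem det4_mul (a b c d a' b' c' d' : E4) : det4 a b c d * det4 a' b' c' d' =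
    Matrix.det (Matrix.of fun i j : Fin 4 => inner ℝ (![a, b, c, d] i) (![a', b', c', d'] j)) := by
  rw [det4, det4, ← Matrix.det_transpose (Matrix.of fun j k : Fin 4 => (![a', b', c', d'] j) k),
    ← Matrix.det_mul]
  congr 1
  ext i j
  simp only [Matrix.mul_apply, Matrix.of_apply, Matrix.transpose_apply, PiLp.inner_apply,
    RCLike.inner_apply, conj_trivial]
  exact Finset.sum_congr rfl fun k _ => mul_comm _ _

theorem det4_map (A : E4 ≃ₗᵢ[ℝ] E4) (a b c d : E4) :
    det4 (A a) (A b) (A c) (A d) =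
      LinearMap.det (A.toLinearEquiv : E4 →ₗ[ℝ] E4) * det4 a b c d := by
  have h : ∀ a b c d : E4, det4 a b c d =
      (EuclideanSpace.basisFun (Fin 4) ℝ).toBasis.det ![a, b, c, d] := by
    intro a b c d
    rw [det4, Module.Basis.det_apply, ← Matrix.det_transpose]
    rfl
  rw [h, h, ← Module.Basis.det_comp]
  congr 1
  ext i : 1
  fin_cases i <;> rfl

theorem linearIndependent_of_det4_ne_zero {a b c d : E4} (h : det4 a b c d ≠ 0) :
    LinearIndependent ℝ ![a, b, c, d] := by
  have hg : (Matrix.gram ℝ ![a, b, c, d]).det ≠ 0 := by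
    have := det4_mul a b c d a b c d
    rw [Matrix.gram, ← this]
    exact mul_ne_zero h h
  exact Matrix.linearIndependent_of_det_gram_ne_zero hg

theorem det4_ne_zero_of_linearIndependent {a b c d : E4} (h : LinearIndependent ℝ ![a, b, c, d]) :
    det4 a b c d ≠ 0 := by
  have hg := (Matrix.posDef_gram_of_linearIndependent h).det_pos
  have := det4_mul a b c d a b c d
  rw [Matrix.gram, ← this] at hg
  exact fun h0 => by simp [h0] at hg

theorem perpForm_self_pos {e c : E4} (h : LinearIndependent ℝ ![e, c]) : 0 < perpForm e c c := by
  have hg := (Matrix.posDef_gram_of_linearIndependent h).det_pos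
  rw [Matrix.det_fin_two] at hg
  simpa [Matrix.gram_apply, perpForm, real_inner_comm] using hg

theorem vertexForm_perpForm_pos {e c d : E4} (h : LinearIndependent ℝ ![e, c, d]) :
    0 < vertexForm (perpForm e) c d d := by
  have hg := (Matrix.posDef_gram_of_linearIndependent h).det_pos
  have he : 0 < inner ℝ e e := real_inner_self_pos.2 (h.ne_zero 0)
  have := mul_pos he hg
  rw [Matrix.det_fin_three] at this
  refine this.trans_eq ?_
  simp only [Matrix.gram_apply, vertexForm, perpForm, Matrix.cons_val_zero, Matrix.cons_val_one,
    Matrix.cons_val]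
  rw [real_inner_comm e c, real_inner_comm e d, real_inner_comm c d]
  ring

/-- The Gram determinants of three of four linearly independent vectors are positive. -/
theorem pos_of_det4_ne_zero {e c d f : E4} (h : det4 e c d f ≠ 0) :
    0 < inner ℝ e e ∧ 0 < perpForm e c c ∧ 0 < vertexForm (perpForm e) c d d := by
  have hli := linearIndependent_of_det4_ne_zero h
  refine ⟨real_inner_self_pos.2 (hli.ne_zero 0), perpForm_self_pos ?_, vertexForm_perpForm_pos ?_⟩
  · convert hli.comp (Fin.castLE (show 2 ≤ 4 by omega)) (Fin.castLE_injective _) using 1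
    ext j : 1
    fin_cases j <;> rfl
  · convert hli.comp (Fin.castLE (show 3 ≤ 4 by omega)) (Fin.castLE_injective _) using 1
    ext j : 1
    fin_cases j <;> rfl

theorem gramDet_perpForm (e c d f : E4) :
    gramDet (perpForm e) c d f = (inner ℝ e e * det4 e c d f) ^ 2 := by
  rw [mul_pow, pow_two (det4 e c d f), det4_mul]
  simp [Matrix.det_succ_row_zero, Fin.sum_univ_succ, Fin.succAbove]
  simp only [gramDet, perpForm, real_inner_comm e c, real_inner_comm e d, real_inner_comm e f,
    real_inner_comm c d, real_inner_comm c f, real_inner_comm d f, real_inner_self_eq_norm_sq]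
  ring

/-- The linear combination of `c`, `d`, `f` on the right-hand side is, up to a multiple of `e`,
normal to the hyperplane spanned by `e`, `c`, `d`; hence it is proportional to the vector product of
`e`, `c`, `d`. -/
theorem inner_mul_det4_mul_det4 {e v : E4} (hv : inner ℝ e v = 0) (c d f : E4) :
    inner ℝ e e * (det4 e c d f * det4 e c d v) =
      vertexForm (perpForm e) c d d * inner ℝ f v - vertexForm (perpForm e) d c f * inner ℝ c v
        - vertexForm (perpForm e) c d f * inner ℝ d v := by
  rw [det4_mul]
  simp [Matrix.det_succ_row_zero, Fin.sum_univ_succ, Fin.succAbove, hv]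
  simp only [vertexForm, perpForm, real_inner_comm e c, real_inner_comm e d, real_inner_comm e f,
    real_inner_comm c d, real_inner_comm c f, real_inner_comm d f, real_inner_self_eq_norm_sq]
  ring

/-- The closing condition of a spherical triangle, in the link of an edge `e` of a 4-simplex: paired
with a vector `v` orthogonal to `e`, the angular velocities at the three 2-faces around `e` add up
to contributions of the three tetrahedra around `e`, each of which depends on that tetrahedron
alone and changes sign with its orientation. -/
theorem sign_mul_angleRate_sum {V : Type*} {k k' : V → V → ℝ} {P : V → E4} {e v : E4}
    (hk : ∀ x y, k x y = perpForm e (P x) (P y)) (hk' : ∀ x y, k' x y = k' y x) {C D F : V}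
    (h : det4 e (P C) (P D) (P F) ≠ 0) (hv : inner ℝ e v = 0) :
    Real.sign (det4 e (P C) (P D) (P F)) *
        (angleRate k k' C D F * (inner ℝ (P C) v / √(k C C))
          + angleRate k k' D F C * (inner ℝ (P D) v / √(k D D))
          + angleRate k k' F C D * (inner ℝ (P F) v / √(k F F))) =
      -(sideRate k k' C D * det4 e (P C) (P D) v + sideRate k k' D F * det4 e (P D) (P F) v
        + sideRate k k' F C * det4 e (P F) (P C) v) := by
  obtain ⟨he, hC, hCD⟩ := pos_of_det4_ne_zero h
  obtain ⟨-, hD, hDF⟩ := pos_of_det4_ne_zero (by rwa [det4_rotate] : det4 e (P D) (P F) (P C) ≠ 0)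
  obtain ⟨-, hF, hFC⟩ := pos_of_det4_ne_zero
    (by rwa [← det4_rotate] : det4 e (P F) (P C) (P D) ≠ 0)
  have hvf : ∀ x y z, vertexForm k x y z = vertexForm (perpForm e) (P x) (P y) (P z) := by
    intro x y z
    simp only [vertexForm, hk]
  have hΔ : gramDet k C D F = (inner ℝ e e * det4 e (P C) (P D) (P F)) ^ 2 := by
    rw [← gramDet_perpForm]
    simp only [gramDet, hk]
  have hk0 : ∀ x y, k x y = k y x := fun x y => by rw [hk, hk, perpForm_comm]
  rw [angleRate_sum hk0 hk' (by rwa [hk]) (by rwa [hk]) (by rwa [hk]) (by rwa [hvf])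
    (by rwa [hvf]) (by rwa [hvf])
    (by rw [hΔ]; positivity)]
  simp only [hvf]
  rw [← inner_mul_det4_mul_det4 hv, ← inner_mul_det4_mul_det4 hv, ← inner_mul_det4_mul_det4 hv,
    det4_rotate e (P C) (P D) (P F), ← det4_rotate e (P F) (P C) (P D), hΔ, Real.sqrt_sq_eq_abs,
    abs_mul, abs_of_pos he]
  rcases lt_or_gt_of_ne h with h0 | h0
  · rw [Real.sign_of_neg h0, abs_of_neg h0]
    field_simp
  · rw [Real.sign_of_pos h0, abs_of_pos h0]
    field_simp

/-! ### Areas of deviated triangles -/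

/-- The first-order variation of `4 S_{A'B'C'} - S_{ABC}`: every side contributes its length times
the outward normal component of its deviation. The outward normal of `AB` in the plane `ABC` is
expressed through `C - A`, and `perpForm` is the squared area of a parallelogram. -/
theorem fderiv_areaIncrement {p w : Fin 3 → E4} (h : LinearIndependent ℝ ![p 1 - p 0, p 2 - p 0])
    (h₀ : inner ℝ (w 0) (p 1 - p 0) = 0) (h₁ : inner ℝ (w 1) (p 2 - p 1) = 0)
    (h₂ : inner ℝ (w 2) (p 0 - p 2) = 0) :
    fderiv ℝ (areaIncrement p) 0 w =
      -(‖p 1 - p 0‖ ^ 2 * inner ℝ (p 2 - p 0) (w 0) + ‖p 2 - p 1‖ ^ 2 * inner ℝ (p 0 - p 1) (w 1)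
        + ‖p 0 - p 2‖ ^ 2 * inner ℝ (p 1 - p 2) (w 2)) /
        √(perpForm (p 1 - p 0) (p 2 - p 0) (p 2 - p 0)) := by
  have hG := perpForm_self_pos h
  set U : E4 := (1 / 2 : ℝ) • (p 2 - p 0) with hU
  set W : E4 := (1 / 2 : ℝ) • (p 2 - p 1) with hW
  have hY : ∀ u : Fin 3 → E4, midpoint ℝ (p 1) (p 2) + u 1 - (midpoint ℝ (p 0) (p 1) + u 0) =
      U + (u 1 - u 0) := by
    intro u
    simp only [midpoint_eq_smul_add, hU, invOf_eq_inv]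
    module
  have hZ : ∀ u : Fin 3 → E4, midpoint ℝ (p 2) (p 0) + u 2 - (midpoint ℝ (p 0) (p 1) + u 0) =
      W + (u 2 - u 0) := by
    intro u
    simp only [midpoint_eq_smul_add, hW, invOf_eq_inv]
    module
  have hfun : areaIncrement p = fun u => 4 * (√(‖U + (u 1 - u 0)‖ ^ 2 * ‖W + (u 2 - u 0)‖ ^ 2 -
      inner ℝ (U + (u 1 - u 0)) (W + (u 2 - u 0)) ^ 2) / 2) - triangleArea (p 0) (p 1) (p 2) := by
    funext u
    rw [areaIncrement, triangleArea, hY, hZ]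
  have hq : ‖U‖ ^ 2 * ‖W‖ ^ 2 - inner ℝ U W ^ 2 =
      perpForm (p 1 - p 0) (p 2 - p 0) (p 2 - p 0) / 4 ^ 2 := by
    rw [hU, hW, show p 2 - p 1 = (p 2 - p 0) - (p 1 - p 0) by abel]
    generalize p 2 - p 0 = b
    generalize p 1 - p 0 = a
    simp only [← real_inner_self_eq_norm_sq, inner_smul_left, inner_smul_right, inner_sub_left,
      inner_sub_right, perpForm, real_inner_comm a b, conj_trivial]
    ring
  have hdiff : DifferentiableAt ℝ (areaIncrement p) 0 := by
    rw [hfun]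
    have : ‖U + ((0 : Fin 3 → E4) 1 - (0 : Fin 3 → E4) 0)‖ ^ 2 *
        ‖W + ((0 : Fin 3 → E4) 2 - (0 : Fin 3 → E4) 0)‖ ^ 2 -
        inner ℝ (U + ((0 : Fin 3 → E4) 1 - (0 : Fin 3 → E4) 0))
          (W + ((0 : Fin 3 → E4) 2 - (0 : Fin 3 → E4) 0)) ^ 2 ≠ 0 := by
      simp only [Pi.zero_apply, sub_zero, add_zero, hq]
      positivity
    have hy : DifferentiableAt ℝ (fun u : Fin 3 → E4 => U + (u 1 - u 0)) 0 := by fun_prop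
    have hz : DifferentiableAt ℝ (fun u : Fin 3 → E4 => W + (u 2 - u 0)) 0 := by fun_prop
    have hin : DifferentiableAt ℝ (fun u : Fin 3 → E4 => ‖U + (u 1 - u 0)‖ ^ 2 *
        ‖W + (u 2 - u 0)‖ ^ 2 - inner ℝ (U + (u 1 - u 0)) (W + (u 2 - u 0)) ^ 2) 0 :=
      ((hy.norm_sq ℝ).mul (hz.norm_sq ℝ)).sub ((hy.inner ℝ hz).pow 2)
    have hs := hin.sqrt this
    fun_prop
  have hline : HasDerivAt (fun t : ℝ => t • w) w 0 := by
    simpa using (hasDerivAt_id (0 : ℝ)).smul_const w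
  have hd := HasFDerivAt.comp_hasDerivAt_of_eq (0 : ℝ) hdiff.hasFDerivAt hline (by simp)
  refine hd.unique ?_
  have hy : HasDerivAt (fun t : ℝ => U + (t • w 1 - t • w 0)) (w 1 - w 0) 0 := by
    simpa [smul_sub] using ((hasDerivAt_id (0 : ℝ)).smul_const (w 1 - w 0)).const_add U
  have hz : HasDerivAt (fun t : ℝ => W + (t • w 2 - t • w 0)) (w 2 - w 0) 0 := by
    simpa [smul_sub] using ((hasDerivAt_id (0 : ℝ)).smul_const (w 2 - w 0)).const_add W
  have h4 := (((((hy.norm_sq.mul hz.norm_sq).sub ((hy.inner ℝ hz).pow 2)).sqrt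
    (by simp [hq]; positivity)).div_const 2).const_mul 4).sub_const (triangleArea (p 0) (p 1) (p 2))
  rw [hfun]
  refine HasDerivAt.congr_deriv h4 ?_
  simp only [Pi.sub_apply, Pi.mul_apply, Pi.pow_apply, zero_smul, sub_zero, add_zero, hq]
  rw [Real.sqrt_div hG.le, Real.sqrt_sq (by norm_num)]
  have hr : 0 < √(perpForm (p 1 - p 0) (p 2 - p 0) (p 2 - p 0)) := Real.sqrt_pos.2 hG
  field_simp
  rw [show p 2 - p 1 = (p 2 - p 0) - (p 1 - p 0) by abel] at h₁ hW ⊢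
  rw [show p 0 - p 2 = -(p 2 - p 0) by abel] at h₂ ⊢
  rw [show p 0 - p 1 = -(p 1 - p 0) by abel, show p 1 - p 2 = (p 1 - p 0) - (p 2 - p 0) by abel]
  rw [hU, hW]
  clear * - h₀ h₁ h₂
  generalize p 2 - p 0 = b at *
  generalize p 1 - p 0 = a at *
  simp only [← real_inner_self_eq_norm_sq, inner_smul_left, inner_smul_right, inner_sub_left,
    inner_sub_right, inner_neg_left, inner_neg_right, real_inner_comm a b, conj_trivial,
    real_inner_comm _ (w 0), real_inner_comm _ (w 1), real_inner_comm _ (w 2)] at *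
  rw [neg_eq_zero] at h₂
  rw [sub_eq_zero] at h₁
  rw [h₀, h₁, h₂]
  norm_num
  ring

/-! ### Positive orderings of the 4-simplices -/

namespace OrientedTriangulation4

variable {V : Type*} (K : OrientedTriangulation4 V)

theorem mem_faces_of_subset {σ τ : Finset V} (hσ : σ ∈ K.faces) (h : τ ⊆ σ) (hτ : τ.Nonempty) :
    τ ∈ K.faces :=
  (K.isRelLowerSet_faces hσ).2 h hτ

variable {K}

theorem IsCell.comp {m n : ℕ} [NeZero m] {u : Fin n ↪ V} (hu : K.IsCell u) (ι : Fin m ↪ Fin n) :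
    K.IsCell (ι.trans u) := by
  refine K.mem_faces_of_subset hu ?_ ⟨u (ι 0), by simp⟩
  intro x hx
  simp only [Finset.mem_map, Finset.mem_univ, true_and, Function.Embedding.trans_apply] at hx ⊢
  obtain ⟨j, hj⟩ := hx
  exact ⟨ι j, hj⟩

theorem trans_mem_pos {s : Fin 5 ↪ V} (hs : s ∈ K.pos) {π : Equiv.Perm (Fin 5)}
    (hπ : Equiv.Perm.sign π = 1) : π.toEmbedding.trans s ∈ K.pos :=
  (K.pos_perm s (K.pos_mem s hs) π).2 ⟨fun _ => hπ, fun _ => hs⟩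

theorem trans_mem_pos_iff (s : Fin 5 ↪ V) {π : Equiv.Perm (Fin 5)}
    (hπ : Equiv.Perm.sign π = 1) : π.toEmbedding.trans s ∈ K.pos ↔ s ∈ K.pos := by
  refine ⟨fun h => ?_, fun h => trans_mem_pos h hπ⟩
  have h' := trans_mem_pos h (π := π⁻¹) (by simp [hπ])
  convert h' using 1
  ext j
  simp

theorem trans_mem_pos_of_notMem {s : Fin 5 ↪ V} (hs : K.IsCell s) (h : s ∉ K.pos)
    {π : Equiv.Perm (Fin 5)} (hπ : Equiv.Perm.sign π = -1) : π.toEmbedding.trans s ∈ K.pos := by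
  refine (K.pos_perm s hs π).2 ⟨fun h' => absurd h' h, fun h' => ?_⟩
  rw [hπ] at h'
  exact absurd h' (by decide)

/-- Every ordered 2-face begins a positively ordered 4-simplex. -/
theorem exists_pos_extending {u : Fin 3 ↪ V} (hu : K.IsCell u) :
    ∃ s ∈ K.pos, s 0 = u 0 ∧ s 1 = u 1 ∧ s 2 = u 2 := by
  classical
  obtain ⟨σ, hσ, hsub, hcard⟩ := K.pure _ hu
  have h2 : (σ \ Finset.univ.map u).card = 2 := by
    rw [Finset.card_sdiff_of_subset hsub, hcard]
    simp
  obtain ⟨a, b, hab, hs⟩ := Finset.card_eq_two.1 h2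
  have ha : a ∈ σ ∧ ∀ j, u j ≠ a := by
    have : a ∈ σ \ Finset.univ.map u := by simp [hs]
    simpa using this
  have hb : b ∈ σ ∧ ∀ j, u j ≠ b := by
    have : b ∈ σ \ Finset.univ.map u := by simp [hs]
    simpa using this
  have hinj : Function.Injective ![u 0, u 1, u 2, a, b] := by
    intro i j hij
    fin_cases i <;> fin_cases j <;>
      simp [ha.2, hb.2, hab, (ha.2 _).symm, (hb.2 _).symm, hab.symm] at hij ⊢
  have hmem : ∀ x, x ∈ Finset.univ.map (⟨_, hinj⟩ : Fin 5 ↪ V) → x ∈ σ := by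
    intro x hx
    simp only [Finset.mem_map, Finset.mem_univ, true_and] at hx
    obtain ⟨j, rfl⟩ := hx
    have hu' : ∀ j, u j ∈ σ := fun j => hsub (by simp)
    fin_cases j
    exacts [hu' 0, hu' 1, hu' 2, ha.1, hb.1]
  have hcell : K.IsCell (⟨_, hinj⟩ : Fin 5 ↪ V) :=
    K.mem_faces_of_subset hσ hmem ⟨u 0, by simp; exact ⟨0, rfl⟩⟩
  by_cases hp : (⟨_, hinj⟩ : Fin 5 ↪ V) ∈ K.pos
  · exact ⟨_, hp, rfl, rfl, rfl⟩
  · exact ⟨_, trans_mem_pos_of_notMem hcell hp (π := Equiv.swap 3 4) (by decide), rfl, rfl, rfl⟩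

theorem finite_cells_through (x : V) (n : ℕ) :
    {u : Fin n ↪ V | K.IsCell u ∧ ∃ j, u j = x}.Finite := by
  have h : ∀ σ : Finset V, {u : Fin n ↪ V | Finset.univ.map u = σ}.Finite := by
    intro σ
    have h1 : {g : Fin n → V | ∀ i, g i ∈ (σ : Set V)}.Finite :=
      Set.Finite.pi' fun _ => σ.finite_toSet
    refine (h1.preimage (f := fun u : Fin n ↪ V => (u : Fin n → V))
      DFunLike.coe_injective.injOn).subset ?_
    rintro u rfl i
    simp
  refine ((K.locallyFinite x).biUnion fun σ _ => h σ).subset ?_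
  rintro u ⟨hu, j, rfl⟩
  simp only [Set.mem_iUnion, Set.mem_ofPred_eq, exists_prop, exists_eq_right']
  exact ⟨hu, by simp⟩

theorem finite_pos_through (x : V) : {s : Fin 5 ↪ V | s ∈ K.pos ∧ s 0 = x}.Finite :=
  (finite_cells_through x 5).subset fun s hs => ⟨K.pos_mem s hs.1, 0, hs.2⟩

/-- The positively ordered 4-simplices that begin with `x, y`. -/
def posThrough (K : OrientedTriangulation4 V) (x y : V) : Finset (Fin 5 ↪ V) :=
  Set.Finite.toFinset (s := {s | s ∈ K.pos ∧ s 0 = x ∧ s 1 = y})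
    ((finite_pos_through x).subset fun _ hs => ⟨hs.1, hs.2.1⟩)

theorem mem_posThrough {x y : V} {s : Fin 5 ↪ V} :
    s ∈ K.posThrough x y ↔ s ∈ K.pos ∧ s 0 = x ∧ s 1 = y := by
  exact Set.Finite.mem_toFinset _

/-- The 4-simplex on the other side of the tetrahedron `s 0, s 1, s 2, s 3`. -/
theorem existsUnique_neighbour {s : Fin 5 ↪ V} (hs : K.IsCell s) :
    ∃! t : Fin 5 ↪ V, K.IsCell t ∧ (∀ j : Fin 4, t j.castSucc = s j.castSucc) ∧ t 4 ≠ s 4 := by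
  classical
  set τ : Finset V := Finset.univ.map (Fin.castSuccEmb.trans s) with hτ
  have hτc : τ ∈ K.faces := hs.comp (Fin.castSuccEmb (n := 4))
  have hmemτ : ∀ j : Fin 4, s j.castSucc ∈ τ := fun j => by simp [hτ]
  -- an ordering that agrees with `s` on the tetrahedron is determined by its vertex set
  have key : ∀ t : Fin 5 ↪ V, (∀ j : Fin 4, t j.castSucc = s j.castSucc) →
      Finset.univ.map t = insert (t 4) τ ∧ t 4 ∉ τ := by
    intro t ht
    have h1 : τ = Finset.univ.map (Fin.castSuccEmb.trans t) := by
      rw [hτ]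
      congr 1
      ext j
      exact (ht j).symm
    constructor
    · ext x
      rw [h1]
      simp only [Finset.mem_map, Finset.mem_univ, true_and, Finset.mem_insert,
        Function.Embedding.trans_apply, Fin.exists_fin_succ', Fin.coe_castSuccEmb]
      constructor
      · rintro (h | h)
        · exact Or.inr h
        · exact Or.inl h.symm
      · rintro (h | h)
        · exact Or.inr h.symm
        · exact Or.inl h
    · rw [h1]
      simp only [Finset.mem_map, Finset.mem_univ, true_and, Function.Embedding.trans_apply,
        EmbeddingLike.apply_eq_iff_eq, Fin.coe_castSuccEmb, not_exists]
      exact fun j => j.castSucc_lt_last.ne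
  obtain ⟨σ₁, σ₂, h12, hset⟩ := Set.ncard_eq_two.1 (K.closed τ hτc (by simp [hτ]))
  have hmem : ∀ t : Fin 5 ↪ V, K.IsCell t → (∀ j : Fin 4, t j.castSucc = s j.castSucc) →
      Finset.univ.map t ∈ ({σ₁, σ₂} : Set (Finset V)) := by
    intro t ht htj
    rw [← hset]
    exact ⟨ht, by rw [(key t htj).1]; exact Finset.subset_insert _ _, by simp⟩
  obtain ⟨σ, hσ, hσs, hσu⟩ : ∃ σ ∈ ({σ₁, σ₂} : Set (Finset V)), σ ≠ Finset.univ.map s ∧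
      ∀ ρ ∈ ({σ₁, σ₂} : Set (Finset V)), ρ ≠ Finset.univ.map s → ρ = σ := by
    rcases hmem s hs (fun _ => rfl) with h | h
    · refine ⟨σ₂, Or.inr rfl, fun h' => h12 (by rw [← h, ← h']), ?_⟩
      rintro ρ (rfl | rfl) hρ
      · exact absurd h.symm hρ
      · rfl
    · refine ⟨σ₁, Or.inl rfl, fun h' => h12 (by rw [h'] ; exact h), ?_⟩
      rintro ρ (rfl | rfl) hρ
      · rfl
      · exact absurd h.symm hρ
  rw [← hset] at hσ
  obtain ⟨hσf, hτσ, hσc⟩ := hσ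
  have h1 : (σ \ τ).card = 1 := by
    rw [Finset.card_sdiff_of_subset hτσ, hσc]
    simp [hτ]
  obtain ⟨e, he⟩ := Finset.card_eq_one.1 h1
  have heσ : e ∈ σ ∧ e ∉ τ := by
    have : e ∈ σ \ τ := by simp [he]
    simpa using this
  have hσe : σ = insert e τ := by
    rw [← Finset.sdiff_union_of_subset hτσ, he]
    rfl
  have hinj : Function.Injective (Fin.snoc (fun j : Fin 4 => s j.castSucc) e : Fin 5 → V) := by
    intro i j
    refine Fin.lastCases ?_ (fun i => ?_) i <;> refine Fin.lastCases ?_ (fun j => ?_) j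
    · simp
    · simp only [Fin.snoc_last, Fin.snoc_castSucc]
      exact fun h => absurd (hmemτ j) (h ▸ heσ.2)
    · simp only [Fin.snoc_last, Fin.snoc_castSucc]
      exact fun h => absurd (hmemτ i) (h ▸ heσ.2)
    · simp
  set t : Fin 5 ↪ V := ⟨_, hinj⟩ with ht
  have htj : ∀ j : Fin 4, t j.castSucc = s j.castSucc := by
    intro j
    simp [ht]
  have ht4 : t 4 = e := by
    exact Fin.snoc_last (n := 4) (α := fun _ => V) e fun j => s j.castSucc
  have htσ : Finset.univ.map t = σ := by rw [(key t htj).1, ht4, hσe]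
  refine ⟨t, ⟨?_, htj, fun h4 => ?_⟩, ?_⟩
  · rw [IsCell, htσ]
    exact hσf
  · apply hσs
    rw [← htσ, (key t htj).1, (key s fun _ => rfl).1, h4]
  · rintro t' ⟨hc, hj, h4⟩
    have h5 : Finset.univ.map t' = σ := by
      refine hσu _ (hmem t' hc hj) fun h => h4 ?_
      have : t' 4 ∈ insert (s 4) τ := by
        rw [← (key s fun _ => rfl).1, ← h]
        simp
      exact (Finset.mem_insert.1 this).resolve_right (key t' hj).2
    have h6 : t' 4 = e := by
      have : t' 4 ∈ insert e τ := by
        rw [← hσe, ← h5]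
        simp
      exact (Finset.mem_insert.1 this).resolve_right (key t' hj).2
    ext i
    refine Fin.lastCases ?_ (fun j => ?_) i
    · exact h6.trans ht4.symm
    · rw [hj, htj]

/-- For a positive ordering `A, B, C, D, E` of a 4-simplex, the positive ordering `A, B, D, C, F` of
its neighbour at the tetrahedron `ABCD`. -/
def acrossTetrahedron {s : Fin 5 ↪ V} (hs : s ∈ K.pos) : Fin 5 ↪ V :=
  (Equiv.swap 2 3).toEmbedding.trans (existsUnique_neighbour (K.pos_mem s hs)).choose

theorem acrossTetrahedron_mem {s : Fin 5 ↪ V} (hs : s ∈ K.pos) :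
    acrossTetrahedron hs ∈ K.pos := by
  obtain ⟨h1, h2, h3⟩ := (existsUnique_neighbour (K.pos_mem s hs)).choose_spec.1
  exact trans_mem_pos_of_notMem h1 (K.coherent s hs _ h1 h2 h3) (by decide)

theorem acrossTetrahedron_apply {s : Fin 5 ↪ V} (hs : s ∈ K.pos) :
    acrossTetrahedron hs 0 = s 0 ∧ acrossTetrahedron hs 1 = s 1 ∧ acrossTetrahedron hs 2 = s 3 ∧
      acrossTetrahedron hs 3 = s 2 ∧ acrossTetrahedron hs 4 ≠ s 4 := by
  obtain ⟨h1, h2, h3⟩ := (existsUnique_neighbour (K.pos_mem s hs)).choose_spec.1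
  exact ⟨h2 0, h2 1, h2 3, h2 2, h3⟩

theorem acrossTetrahedron_acrossTetrahedron {s : Fin 5 ↪ V} (hs : s ∈ K.pos) :
    acrossTetrahedron (acrossTetrahedron_mem hs) = s := by
  have ht := acrossTetrahedron_mem hs
  obtain ⟨a0, a1, a2, a3, a4⟩ := acrossTetrahedron_apply hs
  have h := (existsUnique_neighbour (K.pos_mem _ ht)).choose_spec.2
    ((Equiv.swap 2 3).toEmbedding.trans s)
    ⟨IsCell.comp (K.pos_mem s hs) _, fun j => by
      fin_cases j
      exacts [a0.symm, a1.symm, a2.symm, a3.symm], fun h => a4 h.symm⟩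
  rw [acrossTetrahedron, ← h]
  ext i
  simp

/-- Around an edge, the contributions of the two sides of every tetrahedron cancel. -/
theorem sum_posThrough_eq_zero (x y : V) {B : V → V → ℝ} (hB : ∀ c d, B d c = -B c d) :
    ∑ s ∈ K.posThrough x y, B (s 2) (s 3) = 0 := by
  have hpos : ∀ s ∈ K.posThrough x y, s ∈ K.pos := fun s hs => (mem_posThrough.1 hs).1
  refine Finset.sum_involution (fun s hs => acrossTetrahedron (hpos s hs)) ?_ ?_ ?_ ?_
  · intro s hs
    obtain ⟨-, -, a2, a3, -⟩ := acrossTetrahedron_apply (hpos s hs)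
    rw [a2, a3, hB (s 2) (s 3), add_neg_cancel]
  · intro s hs _ h
    have a2 := (acrossTetrahedron_apply (hpos s hs)).2.2.1
    rw [h] at a2
    exact absurd (s.injective a2) (by decide)
  · intro s hs
    obtain ⟨-, h0, h1⟩ := mem_posThrough.1 hs
    obtain ⟨a0, a1, -⟩ := acrossTetrahedron_apply (hpos s hs)
    exact mem_posThrough.2 ⟨acrossTetrahedron_mem _, a0.trans h0, a1.trans h1⟩
  · intro s hs
    exact acrossTetrahedron_acrossTetrahedron (hpos s hs)

/-- A sum over the positive orderings that begin with `x, y` may be taken in groups of three that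
differ by a cyclic permutation of the other vertices. -/
theorem sum_posThrough_rotate (x y : V) (h : V → V → V → ℝ) :
    ∑ s ∈ K.posThrough x y, h (s 3) (s 4) (s 2) = ∑ s ∈ K.posThrough x y, h (s 2) (s 3) (s 4) := by
  refine Finset.sum_nbij' (fun s => (Equiv.swap (2 : Fin 5) 3 * Equiv.swap 3 4).toEmbedding.trans s)
    (fun s => (Equiv.swap (3 : Fin 5) 4 * Equiv.swap 2 3).toEmbedding.trans s) ?_ ?_ ?_ ?_ ?_
  · intro s hs
    obtain ⟨h, h0, h1⟩ := mem_posThrough.1 hs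
    exact mem_posThrough.2 ⟨trans_mem_pos h (by decide), h0, h1⟩
  · intro s hs
    obtain ⟨h, h0, h1⟩ := mem_posThrough.1 hs
    exact mem_posThrough.2 ⟨trans_mem_pos h (by decide), h0, h1⟩
  · intro s _
    ext j
    simp
  · intro s _
    ext j
    simp
  · intro s _
    rfl

end OrientedTriangulation4

/-! ### Deficit angles of a flat realisation -/

theorem isSqLength_edgeClass {V : Type*} (Γ : Type*) [Group Γ] [MulAction Γ V] (a : Fin 2 ↪ V) :
    IsSqLength (edgeClass Γ a) where
  symm x y := by
    simp only [edgeClass]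
    congr 1
    simp only [or_comm, and_comm]
  diag x := by
    rw [edgeClass, if_neg]
    rintro ⟨γ, ⟨h1, h2⟩ | ⟨h1, h2⟩⟩ <;>
      simpa using a.injective (smul_left_cancel γ (h1.symm.trans h2))

theorem edgeClass_smul {V : Type*} {Γ : Type*} [Group Γ] [MulAction Γ V] (a : Fin 2 ↪ V) (γ : Γ)
    (x y : V) : edgeClass Γ a (γ • x) (γ • y) = edgeClass Γ a x y := by
  simp only [edgeClass]
  congr 1
  refine propext ⟨?_, ?_⟩
  · rintro ⟨δ, h⟩
    refine ⟨γ⁻¹ * δ, ?_⟩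
    simpa only [mul_smul, eq_inv_smul_iff] using h
  · rintro ⟨δ, h⟩
    refine ⟨γ * δ, ?_⟩
    simpa only [mul_smul, smul_left_cancel_iff] using h

namespace OrientedTriangulation4.FlatRealisation

variable {V : Type*} {K : OrientedTriangulation4 V} {Γ : Type*} [Group Γ] [MulAction Γ V]
  (f : K.FlatRealisation Γ)

theorem isSqLength_sqDist : IsSqLength f.sqDist where
  symm x y := by simp only [sqDist, dist_comm]
  diag x := by simp [sqDist]

theorem gramForm_sqDist (A P Q : V) :
    gramForm f.sqDist A P Q = inner ℝ (f.pt P - f.pt A) (f.pt Q - f.pt A) := by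
  have h := norm_sub_sq_real (f.pt P - f.pt A) (f.pt Q - f.pt A)
  rw [sub_sub_sub_cancel_right] at h
  simp only [gramForm, sqDist, dist_comm (f.pt A), dist_eq_norm]
  linarith

theorem linkForm_sqDist (A B P Q : V) : linkForm f.sqDist A B P Q =
    perpForm (f.pt B - f.pt A) (f.pt P - f.pt A) (f.pt Q - f.pt A) := by
  simp only [linkForm, perpForm, gramForm_sqDist]

theorem simplexSign_eq (s : Fin 5 → V) : f.simplexSign s =
    Real.sign (det4 (f.pt (s 1) - f.pt (s 0)) (f.pt (s 2) - f.pt (s 0)) (f.pt (s 3) - f.pt (s 0))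
      (f.pt (s 4) - f.pt (s 0))) := by
  rw [simplexSign, det4]
  congr 2
  ext j k
  fin_cases j <;> rfl

theorem det4_ne_zero {s : Fin 5 ↪ V} (hs : s ∈ K.pos) :
    det4 (f.pt (s 1) - f.pt (s 0)) (f.pt (s 2) - f.pt (s 0)) (f.pt (s 3) - f.pt (s 0))
      (f.pt (s 4) - f.pt (s 0)) ≠ 0 := by
  have h := (affineIndependent_iff_linearIndependent_vsub ℝ _ (0 : Fin 5)).1 (f.nondegenerate s hs)
  have h2 := h.comp (fun j : Fin 4 => (⟨j.succ, Fin.succ_ne_zero j⟩ : {x : Fin 5 // x ≠ 0}))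
    fun i j hij => by simpa using hij
  refine det4_ne_zero_of_linearIndependent ?_
  have h3 : ![f.pt (s 1) - f.pt (s 0), f.pt (s 2) - f.pt (s 0), f.pt (s 3) - f.pt (s 0),
      f.pt (s 4) - f.pt (s 0)] = (fun i : {x : Fin 5 // x ≠ 0} => f.pt (s i) -ᵥ f.pt (s 0)) ∘
        fun j : Fin 4 => ⟨j.succ, Fin.succ_ne_zero j⟩ := by
    ext j : 1
    fin_cases j <;> rfl
  rw [h3]
  exact h2

/-- The velocity of the dihedral angle of the 4-simplex `s` at its face `s 0, s 1, s 2`, when the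
squared lengths vary with velocity `η`. -/
def dihedralRate (η : V → V → ℝ) (s : Fin 5 → V) : ℝ :=
  angleRate (linkForm f.sqDist (s 0) (s 1)) (linkRate f.sqDist η (s 0) (s 1)) (s 2) (s 3) (s 4)

theorem hasDerivAt_dihedralAngle {η : V → V → ℝ} (hη : IsSqLength η) {s : Fin 5 ↪ V}
    (hs : s ∈ K.pos) :
    HasDerivAt (fun t : ℝ => dihedralAngle (f.sqDist + t • η) s) (f.dihedralRate η s) 0 := by
  have h := f.det4_ne_zero hs
  obtain ⟨he, hC, hCD⟩ := pos_of_det4_ne_zero h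
  obtain ⟨-, -, hCF⟩ := pos_of_det4_ne_zero (by
    rw [det4_swap, neg_ne_zero, ← det4_rotate]
    exact h : det4 (f.pt (s 1) - f.pt (s 0)) (f.pt (s 2) - f.pt (s 0)) (f.pt (s 4) - f.pt (s 0))
      (f.pt (s 3) - f.pt (s 0)) ≠ 0)
  refine _root_.hasDerivAt_dihedralAngle f.isSqLength_sqDist hη ?_ ?_ ?_ ?_ ?_
  · rw [← gramForm_self f.isSqLength_sqDist, gramForm_sqDist]
    exact he
  · simpa only [vertexForm, linkForm_sqDist] using hCD
  · simpa only [vertexForm, linkForm_sqDist] using hCF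
  · rwa [linkForm_sqDist]
  · have := gramDet_perpForm (f.pt (s 1) - f.pt (s 0)) (f.pt (s 2) - f.pt (s 0))
      (f.pt (s 3) - f.pt (s 0)) (f.pt (s 4) - f.pt (s 0))
    simp only [gramDet, linkForm_sqDist] at this ⊢
    rw [this]
    positivity

/-- The velocity of the deficit angle at the face `u`, when the squared lengths vary with
velocity `η`. -/
def deficitRate (η : V → V → ℝ) (u : Fin 3 ↪ V) : ℝ :=
  deriv (fun t : ℝ => f.deficit (f.sqDist + t • η) u) 0

open Classical in
theorem deficitRate_eq {η : V → V → ℝ} (hη : IsSqLength η) (u : Fin 3 ↪ V) :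
    f.deficitRate η u = -∑ s ∈ K.posThrough (u 0) (u 1) with s 2 = u 2,
      f.simplexSign s * f.dihedralRate η s := by
  have hsum : ∀ L : V → V → ℝ, f.deficit L u = -∑ s ∈ K.posThrough (u 0) (u 1) with s 2 = u 2,
      f.simplexSign s * dihedralAngle L s := by
    intro L
    rw [deficit, ← finsum_mem_finset_eq_sum]
    congr 1
    refine finsum_congr fun s => ?_
    have : (s ∈ K.pos ∧ s 0 = u 0 ∧ s 1 = u 1 ∧ s 2 = u 2) ↔
        s ∈ ({s ∈ K.posThrough (u 0) (u 1) | s 2 = u 2} : Finset (Fin 5 ↪ V)) := by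
      simp only [Finset.mem_filter, mem_posThrough]
      tauto
    exact finsum_congr_Prop (propext this) fun _ => rfl
  rw [deficitRate]
  simp only [hsum]
  refine HasDerivAt.deriv (HasDerivAt.neg (HasDerivAt.fun_sum fun s hs => ?_))
  exact (f.hasDerivAt_dihedralAngle hη
    (mem_posThrough.1 (Finset.mem_filter.1 hs).1).1).const_mul _

/-! ### Symmetries of the deficit angles -/

theorem deficit_congr {L : V → V → ℝ} {u u' : Fin 3 ↪ V} (e : (Fin 5 ↪ V) ≃ (Fin 5 ↪ V))
    (h : ∀ s, (e s ∈ K.pos ∧ e s 0 = u' 0 ∧ e s 1 = u' 1 ∧ e s 2 = u' 2) ↔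
      (s ∈ K.pos ∧ s 0 = u 0 ∧ s 1 = u 1 ∧ s 2 = u 2))
    (hs : ∀ s, f.simplexSign (e s) * dihedralAngle L (e s) = f.simplexSign s * dihedralAngle L s) :
    f.deficit L u' = f.deficit L u := by
  rw [deficit, deficit]
  congr 1
  rw [← finsum_comp_equiv e]
  exact finsum_congr fun s => finsum_congr_Prop (propext (h s)) fun _ => hs s

/-- Precomposition with a permutation of the vertices. -/
def permOrdering (V : Type*) (π : Equiv.Perm (Fin 5)) : (Fin 5 ↪ V) ≃ (Fin 5 ↪ V) where
  toFun s := π.toEmbedding.trans s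
  invFun s := π.symm.toEmbedding.trans s
  left_inv s := by ext; simp
  right_inv s := by ext; simp

theorem deficit_rotate {L : V → V → ℝ} (hL : IsSqLength L) {u u' : Fin 3 ↪ V} (h0 : u' 0 = u 1)
    (h1 : u' 1 = u 2) (h2 : u' 2 = u 0) : f.deficit L u' = f.deficit L u := by
  refine f.deficit_congr (permOrdering V (Equiv.swap 0 1 * Equiv.swap 1 2)) (fun s => ?_)
    fun s => ?_
  · rw [h0, h1, h2]
    refine and_congr (trans_mem_pos_iff s (by decide)) ?_
    change s 1 = u 1 ∧ s 2 = u 2 ∧ s 0 = u 0 ↔ _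
    tauto
  · congr 1
    · rw [simplexSign_eq, simplexSign_eq]
      change Real.sign (det4 (f.pt (s 2) - f.pt (s 1)) (f.pt (s 0) - f.pt (s 1))
        (f.pt (s 3) - f.pt (s 1)) (f.pt (s 4) - f.pt (s 1))) = _
      congr 1
      simp only [det4_expand, PiLp.sub_apply]
      ring
    · change Real.arccos (borderedGram L (s 1) (s 2) (s 0) (s 3) (s 4) /
        √(borderedGram L (s 1) (s 2) (s 0) (s 3) (s 3) *
          borderedGram L (s 1) (s 2) (s 0) (s 4) (s 4))) = _
      simp only [borderedGram_rotate hL]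
      rfl

theorem deficit_swap {L : V → V → ℝ} (hL : IsSqLength L) {u u' : Fin 3 ↪ V} (h0 : u' 0 = u 1)
    (h1 : u' 1 = u 0) (h2 : u' 2 = u 2) : f.deficit L u' = f.deficit L u := by
  refine f.deficit_congr (permOrdering V (Equiv.swap 0 1 * Equiv.swap 3 4)) (fun s => ?_)
    fun s => ?_
  · rw [h0, h1, h2]
    refine and_congr (trans_mem_pos_iff s (by decide)) ?_
    change s 1 = u 1 ∧ s 0 = u 0 ∧ s 2 = u 2 ↔ _
    tauto
  · congr 1
    · rw [simplexSign_eq, simplexSign_eq]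
      change Real.sign (det4 (f.pt (s 0) - f.pt (s 1)) (f.pt (s 2) - f.pt (s 1))
        (f.pt (s 4) - f.pt (s 1)) (f.pt (s 3) - f.pt (s 1))) = _
      congr 1
      simp only [det4_expand, PiLp.sub_apply]
      ring
    · change Real.arccos (borderedGram L (s 1) (s 0) (s 2) (s 4) (s 3) /
        √(borderedGram L (s 1) (s 0) (s 2) (s 4) (s 4) *
          borderedGram L (s 1) (s 0) (s 2) (s 3) (s 3))) = _
      simp only [borderedGram_swap hL, borderedGram_comm hL _ _ _ (s 4) (s 3)]
      rw [mul_comm (borderedGram ..)]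
      rfl

theorem pt_smul_sub (γ : Γ) (x y : V) : f.pt (γ • x) - f.pt (γ • y) =
    (f.hol γ).linearIsometryEquiv (f.pt x - f.pt y) := by
  rw [f.equivariant, f.equivariant]
  exact ((f.hol γ).map_vsub _ _).symm

theorem simplexSign_smul (γ : Γ) (s : Fin 5 ↪ V) :
    f.simplexSign (γ • s : Fin 5 ↪ V) = f.simplexSign s := by
  simp only [simplexSign_eq, Function.Embedding.smul_apply, pt_smul_sub, det4_map, f.proper,
    one_mul]

theorem sqDist_smul (γ : Γ) (x y : V) : f.sqDist (γ • x) (γ • y) = f.sqDist x y := by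
  simp only [sqDist, dist_eq_norm, pt_smul_sub, LinearIsometryEquiv.norm_map]

theorem deficit_smul (hΓ : K.IsDeckAction Γ) {L : V → V → ℝ} {γ : Γ}
    (hL : ∀ x y : V, L (γ • x) (γ • y) = L x y) (u : Fin 3 ↪ V) :
    f.deficit L (γ • u) = f.deficit L u := by
  refine f.deficit_congr (MulAction.toPerm γ) (fun s => ?_) fun s => ?_
  · have h : γ • s ∈ K.pos ↔ s ∈ K.pos := by
      refine ⟨fun h => ?_, fun h => hΓ.pos_smul γ s h⟩
      have := hΓ.pos_smul γ⁻¹ _ h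
      rwa [← Function.Embedding.smul_def, inv_smul_smul] at this
    simp [h]
  · simp only [MulAction.toPerm_apply, simplexSign_smul, dihedralAngle, borderedGram, hL,
      Function.Embedding.smul_apply]

/-! ### The sum around an edge -/

/-- The velocity of the deficit angle at the face `u`, multiplied by the part of the area
differential at `u` that comes from the deviation of the side `u 0, u 1`, with the opposite sign: the inward
normal of the side is used. -/
def sideTerm (η : V → V → ℝ) (v : V → V → E4) (u : Fin 3 ↪ V) : ℝ :=
  f.deficitRate η u * (‖f.pt (u 1) - f.pt (u 0)‖ ^ 2 *
    (inner ℝ (f.pt (u 2) - f.pt (u 0)) (v (u 0) (u 1)) /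
      √(linkForm f.sqDist (u 0) (u 1) (u 2) (u 2))))

/-- Around one edge, the velocities of the deficit angles, as infinitesimal rotations, add up to
zero. -/
theorem sum_sideTerm_eq_zero {η : V → V → ℝ} (hη : IsSqLength η) {v : V → V → E4} {x y : V}
    (hv : inner ℝ (v x y) (f.pt y - f.pt x) = 0) {U : Finset (Fin 3 ↪ V)}
    (hU : ∀ u, u ∈ U ↔ K.IsCell u ∧ u 0 = x ∧ u 1 = y) : ∑ u ∈ U, f.sideTerm η v u = 0 := by
  classical
  set W : V → ℝ := fun z => inner ℝ (f.pt z - f.pt x) (v x y) / √(linkForm f.sqDist x y z z)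
    with hW
  have h1 : ∀ u ∈ U, f.sideTerm η v u = -‖f.pt y - f.pt x‖ ^ 2 *
      ∑ s ∈ K.posThrough x y with (Fin.castLEEmb (by omega : 3 ≤ 5)).trans s = u,
        f.simplexSign s * (f.dihedralRate η s * W (s 2)) := by
    intro u hu
    obtain ⟨-, rfl, rfl⟩ := (hU u).1 hu
    have h2 : ({s ∈ K.posThrough (u 0) (u 1) | s 2 = u 2} : Finset (Fin 5 ↪ V)) =
        {s ∈ K.posThrough (u 0) (u 1) | (Fin.castLEEmb (by omega : 3 ≤ 5)).trans s = u} := by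
      refine Finset.filter_congr fun s hs => ?_
      obtain ⟨-, a0, a1⟩ := mem_posThrough.1 hs
      constructor
      · intro a2
        ext j
        fin_cases j
        exacts [a0, a1, a2]
      · rintro rfl
        rfl
    rw [sideTerm, deficitRate_eq f hη, h2]
    have h3 : ∑ s ∈ K.posThrough (u 0) (u 1) with (Fin.castLEEmb (by omega : 3 ≤ 5)).trans s = u,
        f.simplexSign s * (f.dihedralRate η s * W (s 2)) =
      (∑ s ∈ K.posThrough (u 0) (u 1) with (Fin.castLEEmb (by omega : 3 ≤ 5)).trans s = u,
        f.simplexSign s * f.dihedralRate η s) * W (u 2) := by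
      rw [Finset.sum_mul]
      refine Finset.sum_congr rfl fun s hs => ?_
      rw [← (Finset.mem_filter.1 hs).2, mul_assoc]
      rfl
    rw [h3]
    ring
  rw [Finset.sum_congr rfl h1, ← Finset.mul_sum, Finset.sum_fiberwise_of_maps_to]
  swap
  · intro s hs
    obtain ⟨a, a0, a1⟩ := mem_posThrough.1 hs
    exact (hU _).2 ⟨IsCell.comp (K.pos_mem s a) _, a0, a1⟩
  set k := linkForm f.sqDist x y with hk
  set k' := linkRate f.sqDist η x y with hk'
  set e := f.pt y - f.pt x with he
  have hkP : ∀ c d, k c d = perpForm e (f.pt c - f.pt x) (f.pt d - f.pt x) :=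
    fun c d => f.linkForm_sqDist x y c d
  set h : V → V → V → ℝ := fun c d g => Real.sign (det4 e (f.pt c - f.pt x) (f.pt d - f.pt x)
    (f.pt g - f.pt x)) * (angleRate k k' c d g * W c) with hh
  set B : V → V → ℝ := fun c d =>
    sideRate k k' c d * det4 e (f.pt c - f.pt x) (f.pt d - f.pt x) (v x y) with hB
  have h4 : ∀ s ∈ K.posThrough x y, f.simplexSign s * (f.dihedralRate η s * W (s 2)) =
      h (s 2) (s 3) (s 4) := by
    intro s hs
    obtain ⟨-, rfl, rfl⟩ := mem_posThrough.1 hs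
    rw [simplexSign_eq]
    rfl
  have h5 : ∀ s ∈ K.posThrough x y, h (s 2) (s 3) (s 4) + h (s 3) (s 4) (s 2) + h (s 4) (s 2) (s 3)
      = -(B (s 2) (s 3) + B (s 3) (s 4) + B (s 4) (s 2)) := by
    intro s hs
    obtain ⟨hs', a0, a1⟩ := mem_posThrough.1 hs
    have hd := f.det4_ne_zero hs'
    rw [a0, a1] at hd
    have := sign_mul_angleRate_sum (P := fun z => f.pt z - f.pt x) hkP
      (linkRate_comm f.isSqLength_sqDist hη x y) hd ((real_inner_comm _ _).trans hv)
    simp only [hh, hB, hW]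
    rw [det4_rotate e (f.pt (s 2) - f.pt x), ← det4_rotate e (f.pt (s 4) - f.pt x), ← mul_add,
      ← mul_add]
    exact this
  have h6 : ∑ s ∈ K.posThrough x y, B (s 2) (s 3) = 0 := by
    refine sum_posThrough_eq_zero x y fun c d => ?_
    simp only [hB]
    rw [sideRate_comm (linkForm_comm f.isSqLength_sqDist x y)
      (linkRate_comm f.isSqLength_sqDist hη x y) d c, det4_swap]
    ring
  have h7 := Finset.sum_congr rfl h5
  simp only [Finset.sum_add_distrib, Finset.sum_neg_distrib] at h7
  have r1 := sum_posThrough_rotate (K := K) x y h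
  have r2 := sum_posThrough_rotate (K := K) x y fun a b c => h b c a
  have r3 := sum_posThrough_rotate (K := K) x y fun a b _ => B a b
  have r4 := sum_posThrough_rotate (K := K) x y fun _ b c => B b c
  rw [Finset.sum_congr rfl h4]
  have : ∑ s ∈ K.posThrough x y, h (s 2) (s 3) (s 4) = 0 := by linarith
  rw [this, mul_zero]

end OrientedTriangulation4.FlatRealisation

/-! ### Area differentials as sums over sides -/

namespace OrientedTriangulation4

variable {V : Type*} {K : OrientedTriangulation4 V} {Γ : Type*} [Group Γ] [MulAction Γ V]

theorem IsCell.isEdge {n : ℕ} {u : Fin n ↪ V} (hu : K.IsCell u) {i j : Fin n} (h : i ≠ j) :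
    K.IsEdge (u i) (u j) :=
  ⟨fun h' => h (u.injective h'), _, hu, by simp, by simp⟩

namespace FlatRealisation

variable (f : K.FlatRealisation Γ)

theorem deficitRate_smul (hΓ : K.IsDeckAction Γ) {η : V → V → ℝ} {γ : Γ}
    (hη : ∀ x y : V, η (γ • x) (γ • y) = η x y) (u : Fin 3 ↪ V) :
    f.deficitRate η (γ • u) = f.deficitRate η u := by
  rw [deficitRate, deficitRate]
  congr 1
  funext t
  exact f.deficit_smul hΓ (fun x y => by simp [sqDist_smul, hη]) u

theorem sideTerm_smul (hΓ : K.IsDeckAction Γ) {η : V → V → ℝ} {γ : Γ}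
    (hη : ∀ x y : V, η (γ • x) (γ • y) = η x y) (v : f.deviations) {u : Fin 3 ↪ V}
    (hu : K.IsCell u) : f.sideTerm η v.1 (γ • u) = f.sideTerm η v.1 u := by
  have hv := (v.2 _ _ (hu.isEdge (by decide : (0 : Fin 3) ≠ 1))).2.2 γ
  rw [sideTerm, sideTerm, deficitRate_smul f hΓ hη]
  simp only [Function.Embedding.smul_apply, linkForm, gramForm, sqDist_smul, pt_smul_sub,
    LinearIsometryEquiv.norm_map, hv, LinearIsometryEquiv.inner_map_map]

theorem sideTerm_swap {η : V → V → ℝ} (hη : IsSqLength η) (v : f.deviations) {u u' : Fin 3 ↪ V}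
    (hu : K.IsCell u) (h0 : u' 0 = u 1) (h1 : u' 1 = u 0) (h2 : u' 2 = u 2) :
    f.sideTerm η v.1 u' = f.sideTerm η v.1 u := by
  obtain ⟨hs, ho, -⟩ := v.2 _ _ (hu.isEdge (by decide : (0 : Fin 3) ≠ 1))
  have hd : f.deficitRate η u' = f.deficitRate η u := by
    rw [deficitRate, deficitRate]
    congr 1
    funext t
    exact f.deficit_swap (f.isSqLength_sqDist.add_smul hη t) h0 h1 h2
  have hk : linkForm f.sqDist (u 1) (u 0) (u 2) (u 2) =
      linkForm f.sqDist (u 0) (u 1) (u 2) (u 2) := by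
    simp only [linkForm, gramForm, f.isSqLength_sqDist.diag, f.isSqLength_sqDist.symm (u 1) (u 0)]
    ring
  have hi : inner ℝ (f.pt (u 2) - f.pt (u 1)) (v.1 (u 0) (u 1)) =
      inner ℝ (f.pt (u 2) - f.pt (u 0)) (v.1 (u 0) (u 1)) := by
    rw [← sub_sub_sub_cancel_right (f.pt (u 2)) (f.pt (u 1)) (f.pt (u 0)), inner_sub_left,
      real_inner_comm _ (f.pt (u 1) - f.pt (u 0)), ho, sub_zero]
  rw [sideTerm, sideTerm, hd, h0, h1, h2, hk, ← hs, hi, norm_sub_rev]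

theorem sideTerm_rotate {η : V → V → ℝ} (hη : IsSqLength η) (v : V → V → E4) {u u' : Fin 3 ↪ V}
    (h0 : u' 0 = u 1) (h1 : u' 1 = u 2) (h2 : u' 2 = u 0) :
    f.deficitRate η u' = f.deficitRate η u ∧
      linkForm f.sqDist (u' 0) (u' 1) (u' 2) (u' 2) = linkForm f.sqDist (u 0) (u 1) (u 2) (u 2) ∧
      f.sideTerm η v u' = f.deficitRate η u * (‖f.pt (u 2) - f.pt (u 1)‖ ^ 2 *
        (inner ℝ (f.pt (u 0) - f.pt (u 1)) (v (u 1) (u 2)) /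
          √(linkForm f.sqDist (u 0) (u 1) (u 2) (u 2)))) := by
  have hd : f.deficitRate η u' = f.deficitRate η u := by
    rw [deficitRate, deficitRate]
    congr 1
    funext t
    exact f.deficit_rotate (f.isSqLength_sqDist.add_smul hη t) h0 h1 h2
  have hk : linkForm f.sqDist (u' 0) (u' 1) (u' 2) (u' 2) =
      linkForm f.sqDist (u 0) (u 1) (u 2) (u 2) := by
    rw [h0, h1, h2]
    simp only [linkForm, gramForm, f.isSqLength_sqDist.diag, f.isSqLength_sqDist.symm (u 1) (u 0),
      f.isSqLength_sqDist.symm (u 2) (u 0)]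
    ring
  refine ⟨hd, hk, ?_⟩
  rw [sideTerm, hd, hk, h0, h1, h2]

/-- A function of ordered faces that is symmetric in the first two vertices takes every value twice
on the orderings of a face. -/
theorem sum_orderings {φ : (Fin 3 ↪ V) → ℝ} {u : Fin 3 ↪ V}
    (hφ : ∀ π : Equiv.Perm (Fin 3),
      φ ((π * Equiv.swap 0 1).toEmbedding.trans u) = φ (π.toEmbedding.trans u)) :
    ∑ π : Equiv.Perm (Fin 3), φ (π.toEmbedding.trans u) =
      2 * (φ u + φ ((finRotate 3).toEmbedding.trans u) +
        φ ((finRotate 3 * finRotate 3).toEmbedding.trans u)) := by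
  have huniv : (Finset.univ : Finset (Equiv.Perm (Fin 3))) =
      {1, finRotate 3, finRotate 3 * finRotate 3, 1 * Equiv.swap 0 1,
        finRotate 3 * Equiv.swap 0 1, finRotate 3 * finRotate 3 * Equiv.swap 0 1} := by
    decide
  have h1 : (1 : Equiv.Perm (Fin 3)).toEmbedding.trans u = u := by
    ext j
    rfl
  rw [huniv, Finset.sum_insert (by decide), Finset.sum_insert (by decide),
    Finset.sum_insert (by decide), Finset.sum_insert (by decide), Finset.sum_insert (by decide),
    Finset.sum_singleton, hφ, hφ, hφ, h1]
  ring

/-- Every side of the face `u` contributes to the area differential at `u`, and the sum over the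
sides is half the sum over the orderings of `u`. -/
theorem deficitRate_mul_fderiv_areaIncrement {η : V → V → ℝ} (hη : IsSqLength η)
    (v : f.deviations) {u : Fin 3 ↪ V} (hu : K.IsCell u) :
    f.deficitRate η u * fderiv ℝ (areaIncrement fun j => f.pt (u j)) 0 (f.sideDeviations u v) =
      -(∑ π : Equiv.Perm (Fin 3), f.sideTerm η v.1 (π.toEmbedding.trans u)) / 2 := by
  obtain ⟨s, hs, a0, a1, a2⟩ := exists_pos_extending hu
  have hli : LinearIndependent ℝ ![f.pt (u 1) - f.pt (u 0), f.pt (u 2) - f.pt (u 0)] := by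
    have h := (linearIndependent_of_det4_ne_zero (f.det4_ne_zero hs)).comp
      (Fin.castLE (show 2 ≤ 4 by omega)) (Fin.castLE_injective _)
    rw [a0, a1, a2] at h
    convert h using 1
    ext j : 1
    fin_cases j <;> rfl
  have e01 := (v.2 _ _ (hu.isEdge (by decide : (0 : Fin 3) ≠ 1))).2.1
  have e12 := (v.2 _ _ (hu.isEdge (by decide : (1 : Fin 3) ≠ 2))).2.1
  have e20 := (v.2 _ _ (hu.isEdge (by decide : (2 : Fin 3) ≠ 0))).2.1
  have hA := fderiv_areaIncrement (p := fun j => f.pt (u j)) (w := f.sideDeviations u v)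
    hli e01 e12 e20
  have hw : f.sideDeviations u v 0 = v.1 (u 0) (u 1) ∧ f.sideDeviations u v 1 = v.1 (u 1) (u 2) ∧
      f.sideDeviations u v 2 = v.1 (u 2) (u 0) := ⟨rfl, rfl, rfl⟩
  obtain ⟨d1, k1, t1⟩ := f.sideTerm_rotate hη v.1 (u := u)
    (u' := (finRotate 3).toEmbedding.trans u) rfl rfl rfl
  obtain ⟨-, -, t2⟩ := f.sideTerm_rotate hη v.1 (u := (finRotate 3).toEmbedding.trans u)
    (u' := (finRotate 3 * finRotate 3).toEmbedding.trans u) rfl rfl rfl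
  rw [d1, k1] at t2
  have hu0 : (finRotate 3).toEmbedding.trans u 0 = u 1 := rfl
  have hu1 : (finRotate 3).toEmbedding.trans u 1 = u 2 := rfl
  have hu2 : (finRotate 3).toEmbedding.trans u 2 = u 0 := rfl
  rw [hu0, hu1, hu2] at t2
  rw [sum_orderings fun π => f.sideTerm_swap hη v (hu.comp π.toEmbedding) rfl rfl rfl, t1, t2,
    hA, hw.1, hw.2.1, hw.2.2, ← f.linkForm_sqDist, sideTerm]
  ring

end FlatRealisation

/-! ### Regrouping faces of the quotient by their sides -/

theorem IsCell.smul (hΓ : K.IsDeckAction Γ) {u : Fin 3 ↪ V} (hu : K.IsCell u) (γ : Γ) :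
    K.IsCell (γ • u) := by
  obtain ⟨s, hs, a0, a1, a2⟩ := exists_pos_extending hu
  have h : γ • u = (Fin.castLEEmb (by omega : 3 ≤ 5)).trans
      (s.trans (MulAction.toPerm γ).toEmbedding) := by
    ext j
    fin_cases j
    exacts [congrArg (γ • ·) a0.symm, congrArg (γ • ·) a1.symm, congrArg (γ • ·) a2.symm]
  rw [h]
  exact IsCell.comp (K.pos_mem _ (hΓ.pos_smul γ s hs)) _

theorem IsDeckAction.eq_one (hΓ : K.IsDeckAction Γ) {n : ℕ} {u : Fin n ↪ V} (hu : K.IsCell u)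
    {γ : Γ} {π π' : Equiv.Perm (Fin n)} (h : ∀ j, u (π' j) = γ • u (π j)) : γ = 1 := by
  refine hΓ.free γ _ hu fun x hx => ?_
  simp only [Finset.mem_map, Finset.mem_univ, true_and] at hx ⊢
  obtain ⟨j, rfl⟩ := hx
  exact ⟨π' (π.symm j), by rw [h, Equiv.apply_symm_apply]⟩

/-- Both sums run over the ordered 2-faces of the quotient by `Γ`: on the left the lifts are chosen
so that their underlying face lies in `F`, on the right so that their first side lies in `E`. -/
theorem sum_faces_eq_sum_edges (hΓ : K.IsDeckAction Γ) {E : Finset (Fin 2 ↪ V)}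
    (hE : K.IsCellSystem Γ E) {F : Finset (Fin 3 ↪ V)} (hF : K.IsCellSystem Γ F)
    {φ : (Fin 3 ↪ V) → ℝ} (hφ : ∀ (γ : Γ) (u : Fin 3 ↪ V), K.IsCell u → φ (γ • u) = φ u)
    {B : Finset (Fin 3 ↪ V)} (hB : ∀ u, u ∈ B ↔ K.IsCell u ∧
      ∃ b ∈ E, ∃ π : Equiv.Perm (Fin 2), u 0 = b (π 0) ∧ u 1 = b (π 1)) :
    ∑ u ∈ F, ∑ π : Equiv.Perm (Fin 3), φ (π.toEmbedding.trans u) = ∑ u ∈ B, φ u := by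
  have hsub : ∀ {w : Fin 3 ↪ V}, K.IsCell w →
      K.IsCell ((Fin.castLEEmb (by omega : 2 ≤ 3)).trans w) := fun h => h.comp _
  have hE1 : ∀ w : Fin 3 ↪ V, K.IsCell w → ∃ γ : Γ, γ • w ∈ B := by
    intro w hw
    obtain ⟨b, ⟨hb, γ, π, h⟩, -⟩ := hE.2 _ (hsub hw)
    have h0 : w 0 = γ • b (π 0) := h 0
    have h1 : w 1 = γ • b (π 1) := h 1
    refine ⟨γ⁻¹, (hB _).2 ⟨hw.smul hΓ _, b, hb, π, ?_, ?_⟩⟩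
    · rw [Function.Embedding.smul_apply, h0, inv_smul_smul]
    · rw [Function.Embedding.smul_apply, h1, inv_smul_smul]
  have hE2 : ∀ (w : Fin 3 ↪ V) (γ : Γ), w ∈ B → γ • w ∈ B → γ • w = w := by
    intro w γ hw hγ
    obtain ⟨-, b, hb, π, h0, h1⟩ := (hB _).1 hw
    obtain ⟨hc, b', hb', π', h0', h1'⟩ := (hB _).1 hγ
    rw [Function.Embedding.smul_apply] at h0' h1'
    have hbb : b' = b := (hE.2 _ (hsub hc)).unique
      ⟨hb', 1, π', fun j => by fin_cases j <;> simp [h0', h1']⟩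
      ⟨hb, γ, π, fun j => by fin_cases j <;> simp [h0, h1]⟩
    subst hbb
    rw [hΓ.eq_one (hE.1 _ hb) (π := π) (π' := π') (γ := γ) fun j => by
      fin_cases j <;> simp [← h0', ← h1', h0, h1], one_smul]
  have hF2 : ∀ u ∈ F, ∀ u' ∈ F, ∀ (π π' : Equiv.Perm (Fin 3)) (γ : Γ),
      π'.toEmbedding.trans u' = γ • π.toEmbedding.trans u → u = u' ∧ π = π' := by
    intro u hu u' hu' π π' γ h
    have hj : ∀ j, u' (π' j) = γ • u (π j) := fun j => DFunLike.congr_fun h j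
    have huu : u = u' := (hF.2 (π'.toEmbedding.trans u') ((hF.1 u' hu').comp _)).unique
      ⟨hu, γ, π, hj⟩ ⟨hu', 1, π', fun j => by simp⟩
    subst huu
    have hγ := hΓ.eq_one (hF.1 u hu) hj
    refine ⟨rfl, Equiv.ext fun j => u.injective ?_⟩
    rw [hj j, hγ, one_smul]
  have hex : ∀ a : (Fin 3 ↪ V) × Equiv.Perm (Fin 3), a ∈ F ×ˢ Finset.univ →
      ∃ γ : Γ, γ • a.2.toEmbedding.trans a.1 ∈ B := fun a ha =>
    hE1 _ ((hF.1 _ (Finset.mem_product.1 ha).1).comp _)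
  choose! g hg using hex
  rw [← Finset.sum_product' F Finset.univ fun u (π : Equiv.Perm (Fin 3)) =>
    φ (π.toEmbedding.trans u)]
  refine Finset.sum_bij (fun a _ => g a • a.2.toEmbedding.trans a.1) hg ?_ ?_ ?_
  · intro a ha a' ha' h
    have h' := hF2 _ (Finset.mem_product.1 ha).1 _ (Finset.mem_product.1 ha').1 a.2 a'.2
      ((g a')⁻¹ * g a) (by rw [mul_smul, h, inv_smul_smul])
    exact Prod.ext h'.1 h'.2
  · intro w hw
    obtain ⟨u, ⟨hu, γ, π, h⟩, -⟩ := hF.2 w ((hB w).1 hw).1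
    have hwu : w = γ • π.toEmbedding.trans u := by
      ext j
      exact h j
    have ha : (u, π) ∈ F ×ˢ (Finset.univ : Finset (Equiv.Perm (Fin 3))) := by simp [hu]
    refine ⟨(u, π), ha, ?_⟩
    have h1 : g (u, π) • π.toEmbedding.trans u = (g (u, π) * γ⁻¹) • w := by
      rw [hwu, mul_smul, inv_smul_smul]
    have h2 := hg _ ha
    rw [h1] at h2
    exact h1.trans (hE2 w _ hw h2)
  · intro a ha
    exact (hφ _ _ ((hF.1 _ (Finset.mem_product.1 ha).1).comp _)).symm

theorem exists_finset_faces_at_edges (K : OrientedTriangulation4 V) (E : Finset (Fin 2 ↪ V)) :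
    ∃ B : Finset (Fin 3 ↪ V), ∀ u, u ∈ B ↔ K.IsCell u ∧
      ∃ b ∈ E, ∃ π : Equiv.Perm (Fin 2), u 0 = b (π 0) ∧ u 1 = b (π 1) := by
  refine Set.Finite.exists_finset (s := {u : Fin 3 ↪ V | K.IsCell u ∧
      ∃ b ∈ E, ∃ π : Equiv.Perm (Fin 2), u 0 = b (π 0) ∧ u 1 = b (π 1)}) ?_
  refine (E.finite_toSet.biUnion fun b _ => Set.finite_iUnion fun π : Equiv.Perm (Fin 2) =>
    finite_cells_through (K := K) (b (π 0)) 3).subset ?_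
  rintro u ⟨hu, b, hb, π, h0, -⟩
  simp only [Set.mem_iUnion]
  exact ⟨b, hb, π, hu, 0, h0⟩

end OrientedTriangulation4

end

theorem theorem2 {V : Type*} (K : OrientedTriangulation4 V)
    {Γ : Type*} [Group Γ] [MulAction Γ V] (hΓ : K.IsDeckAction Γ)
    (f : K.FlatRealisation Γ)
    (E : Finset (Fin 2 ↪ V)) (hE : K.IsCellSystem Γ E)
    (F : Finset (Fin 3 ↪ V)) (hF : K.IsCellSystem Γ F) :
    LinearMap.range (f.areaMap F) ≤ LinearMap.ker (f.edgeDeficitMap E F) := by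
  classical
  rintro _ ⟨v, rfl⟩
  rw [LinearMap.mem_ker]
  funext a
  set η := edgeClass Γ a.1
  have hη : IsSqLength η := isSqLength_edgeClass Γ a.1
  have hrow : f.edgeDeficitMap E F (f.areaMap F v) a = ∑ i : F, f.deficitRate η i.1 *
      fderiv ℝ (areaIncrement fun j => f.pt (i.1 j)) 0 (f.sideDeviations i.1 v) := rfl
  obtain ⟨B, hB⟩ := OrientedTriangulation4.exists_finset_faces_at_edges K E
  rw [hrow, Finset.sum_coe_sort F fun i => f.deficitRate η i *
      fderiv ℝ (areaIncrement fun j => f.pt (i j)) 0 (f.sideDeviations i v),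
    Finset.sum_congr rfl fun i hi => f.deficitRate_mul_fderiv_areaIncrement hη v (hF.1 i hi),
    ← Finset.sum_div, Finset.sum_neg_distrib, OrientedTriangulation4.sum_faces_eq_sum_edges hΓ hE hF
      (fun γ u hu => f.sideTerm_smul hΓ (edgeClass_smul a.1 γ) v hu) hB,
    ← Finset.sum_fiberwise_of_maps_to (t := B.image fun u => (u 0, u 1))
      (g := fun u => (u 0, u 1)) fun u hu => Finset.mem_image_of_mem _ hu,
    Finset.sum_eq_zero, neg_zero, zero_div, Pi.zero_apply]
  intro p hp
  obtain ⟨w, hw, rfl⟩ := Finset.mem_image.1 hp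
  obtain ⟨hc, hb⟩ := (hB w).1 hw
  refine f.sum_sideTerm_eq_zero hη (x := w 0) (y := w 1)
    (v.2 _ _ (hc.isEdge (by decide : (0 : Fin 3) ≠ 1))).2.1 fun u => ?_
  rw [Finset.mem_filter, hB, Prod.mk.injEq]
  constructor
  · rintro ⟨⟨h, -⟩, h0, h1⟩
    exact ⟨h, h0, h1⟩
  · rintro ⟨h, h0, h1⟩
    exact ⟨⟨h, by rwa [h0, h1]⟩, h0, h1⟩
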